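/- Let $p$ be an odd prime and let $\alpha\in\mathbb Z_p^\times$. For $x\in\mathbb Z_p$ let $\langle x\rangle_p\in\{0,1,\dots,p-1\}$ denote the least nonnegative residue of $x$ modulo $p$, and put $\alpha_p^*=(\alpha+\langle-\alpha\rangle_p)/p\in\mathbb Z_p$. Let $\Gamma_p$ be Morita's $p$-adic Gamma function, i.e. the continuous function on $\mathbb Z_p$ with $\Gamma_p(n)=(-1)^n\prod_{1\le k<n,\ p\nmid k}k$ for all integers $n\ge 0$. Let $(x)_k=x(x+1)\cdots(x+k-1)$ and $$F_p(\alpha)={}_5F_4\left[\begin{matrix}\alpha&1+\frac{\alpha}2&\alpha&\alpha&\alpha\\&\frac{\alpha}2&1&1&1\end{matrix}\,\bigg|\,1\right]_{p-1}=\sum_{k=0}^{p-1}\frac{(1+\frac{\alpha}{2})_k}{(\frac{\alpha}{2})_k}\cdot\frac{(\alpha)_k^4}{(k!)^4},$$ where the quotient $(1+\frac{\alpha}{2})_k/(\frac{\alpha}{2})_k$ is read as its continuous extension $(\alpha+2k)/\alpha$ if $\alpha$ is a negative even integer with $(\frac{\alpha}{2})_k=0$. (1) If $\langle-\alpha\rangle_p\geq(p+1)/2$,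 then $$F_p(\alpha)\equiv -p^2\alpha_p^*(1-2\alpha_p^*)\cdot\frac{\Gamma_p(1-2\alpha)}{\Gamma_p(1+\alpha)\Gamma_p(1-\alpha)^3}\pmod{p^4}.$$ (2) If $p\geq 5$ and $\langle-\alpha\rangle_p\leq(p-1)/2$, then $$F_p(\alpha)\equiv -p\alpha_p^*\cdot\frac{\Gamma_p(1-2\alpha)}{\Gamma_p(1+\alpha)\Gamma_p(1-\alpha)^3}\pmod{p^4}.$$ -/

import Mathlib

open Filter Topology

/-- The truncated hypergeometric series
`∑_{k=0}^{n} (a₀)_k ⋯ (a_r)_k / ((b₁)_k ⋯ (b_r)_k) · z ^ k / k!`. -/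
noncomputable def truncHyp {K : Type*} [Field K] {r : ℕ} (a : Fin (r + 1) → K) (b : Fin r → K)
    (z : K) (n : ℕ) : K :=
  ∑ k ∈ Finset.range (n + 1),
    (∏ i, (ascPochhammer K k).eval (a i)) / (∏ i, (ascPochhammer K k).eval (b i)) *
      (z ^ k / (k.factorial : K))

/-- The values `Γ_p(n) = (-1)^n ∏_{1 ≤ k < n, p ∤ k} k` of Morita's Gamma function on `ℕ`
(in particular `Γ_p(0) = 1`). -/
def padicGammaNat (p n : ℕ) : ℤ :=
  (-1) ^ n * ∏ k ∈ (Finset.Ico 1 n).filter (fun k => ¬ p ∣ k), (k : ℤ)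

/-- Morita's `p`-adic Gamma function: `Γ_p(x)` is the limit of `Γ_p(n)` as the natural number `n`
tends to `x` in the `p`-adic norm. -/
noncomputable def padicGamma (p : ℕ) [Fact p.Prime] (x : ℤ_[p]) : ℤ_[p] :=
  limUnder (comap (fun n : ℕ => (n : ℤ_[p])) (𝓝 x)) (fun n : ℕ => ((padicGammaNat p n : ℤ) : ℤ_[p]))

/-- `α* = (α + ⟨-α⟩_p) / p`, where `⟨x⟩_p = x.zmodRepr` is the least nonnegative residue of `x`
modulo `p`. -/
noncomputable def padicDash (p : ℕ) [Fact p.Prime] (α : ℤ_[p]) : ℚ_[p] :=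
  ((α : ℚ_[p]) + ((-α).zmodRepr : ℚ_[p])) / (p : ℚ_[p])

/-- The congruence `x ≡ y (mod p^n)` in `ℚ_p`, that is `x - y ∈ p^n ℤ_p`. -/
def PadicCongr (p : ℕ) [Fact p.Prime] (n : ℕ) (x y : ℚ_[p]) : Prop :=
  ∃ z : ℤ_[p], x - y = (p : ℚ_[p]) ^ n * (z : ℚ_[p])

/-- The truncated well-poised series `₅F₄[α, 1 + α/2, α, α, α; α/2, 1, 1, 1 | 1]_n`. When
`α ∈ {-2, -4, …}` some quotients `(1 + α/2)_k / (α/2)_k` have the form `0 / 0`; the singularity is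
removable, and the value there is the limit from nearby parameters. Where no lower parameter
vanishes this is the literal series (`wellPoised5F4_eq_truncHyp`), and in all cases it is obtained
by cancelling the common factors (`wellPoised5F4_eq_sum`). -/
noncomputable def wellPoised5F4 (p : ℕ) [Fact p.Prime] (α : ℚ_[p]) (n : ℕ) : ℚ_[p] :=
  limUnder (𝓝[≠] α)
    (fun x => truncHyp ![x, 1 + x / 2, x, x, x] ![x / 2, 1, 1, 1] 1 n)

theorem truncHyp_wellPoised (p : ℕ) [Fact p.Prime] (x : ℚ_[p]) (n : ℕ)
    (h : ∀ j < n, x / 2 + (j : ℚ_[p]) ≠ 0) (h0 : x ≠ 0) :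
    truncHyp ![x, 1 + x / 2, x, x, x] ![x / 2, 1, 1, 1] 1 n =
      ∑ k ∈ Finset.range (n + 1), (x + 2 * (k : ℚ_[p])) / x *
        ((ascPochhammer ℚ_[p] k).eval x / (k.factorial : ℚ_[p])) ^ 4 := by
  have key : ∀ k : ℕ, (ascPochhammer ℚ_[p] k).eval (1 + x / 2) * (x / 2) =
      (ascPochhammer ℚ_[p] k).eval (x / 2) * (x / 2 + k) := by
    intro k
    rw [← ascPochhammer_succ_eval, ascPochhammer_succ_left]
    simp [Polynomial.eval_comp, add_comm, mul_comm]
  have nz : ∀ k ≤ n, (ascPochhammer ℚ_[p] k).eval (x / 2) ≠ 0 := by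
    intro k
    induction k with
    | zero => simp
    | succ k ih =>
      intro hk
      rw [ascPochhammer_succ_eval]
      exact mul_ne_zero (ih (by omega)) (h k (by omega))
  unfold truncHyp
  refine Finset.sum_congr rfl fun k hk => ?_
  have hk' := nz k (by simpa [Nat.lt_succ_iff] using hk)
  have hf : (k.factorial : ℚ_[p]) ≠ 0 := by exact_mod_cast k.factorial_ne_zero
  have e1 : (ascPochhammer ℚ_[p] k).eval (1 : ℚ_[p]) = k.factorial := by simp
  have h2 : (ascPochhammer ℚ_[p] k).eval (1 + x / 2) =
      (ascPochhammer ℚ_[p] k).eval (x / 2) * ((x + 2 * k) / x) := by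
    have := key k
    field_simp at this ⊢
    linear_combination this
  have hu : ∏ i, (ascPochhammer ℚ_[p] k).eval ((![x, 1 + x / 2, x, x, x] : Fin 5 → ℚ_[p]) i) =
      (ascPochhammer ℚ_[p] k).eval x * (ascPochhammer ℚ_[p] k).eval (1 + x / 2) *
        (ascPochhammer ℚ_[p] k).eval x * (ascPochhammer ℚ_[p] k).eval x *
        (ascPochhammer ℚ_[p] k).eval x := by
    rw [Fin.prod_univ_five]
    rfl
  rw [hu, h2]
  simp only [Fin.prod_univ_four, Matrix.cons_val, e1, one_pow]
  field_simp

theorem tendsto_truncHyp_wellPoised (p : ℕ) [Fact p.Prime] (α : ℚ_[p]) (n : ℕ) (h0 : α ≠ 0) :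
    Tendsto (fun x : ℚ_[p] => truncHyp ![x, 1 + x / 2, x, x, x] ![x / 2, 1, 1, 1] 1 n) (𝓝[≠] α)
      (𝓝 (∑ k ∈ Finset.range (n + 1), (α + 2 * (k : ℚ_[p])) / α *
        ((ascPochhammer ℚ_[p] k).eval α / (k.factorial : ℚ_[p])) ^ 4)) := by
  have hc : Tendsto (fun x : ℚ_[p] => ∑ k ∈ Finset.range (n + 1), (x + 2 * (k : ℚ_[p])) / x *
        ((ascPochhammer ℚ_[p] k).eval x / (k.factorial : ℚ_[p])) ^ 4) (𝓝[≠] α)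
      (𝓝 (∑ k ∈ Finset.range (n + 1), (α + 2 * (k : ℚ_[p])) / α *
        ((ascPochhammer ℚ_[p] k).eval α / (k.factorial : ℚ_[p])) ^ 4)) := by
    refine Tendsto.mono_left ?_ nhdsWithin_le_nhds
    refine tendsto_finsetSum _ fun k _ => ?_
    refine Tendsto.mul (Tendsto.div (tendsto_id.add_const _) tendsto_id h0) ?_
    exact (((ascPochhammer ℚ_[p] k).continuous.tendsto α).div_const _).pow 4
  refine hc.congr' ?_
  have h1 : ∀ᶠ x in 𝓝[≠] α, ∀ j ∈ Finset.range n, x / 2 + (j : ℚ_[p]) ≠ 0 := by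
    rw [Filter.eventually_all_finset]
    intro j _
    have hj : ∀ᶠ x in 𝓝[≠] α, x ≠ -2 * (j : ℚ_[p]) := by
      by_cases hα : α = -2 * (j : ℚ_[p])
      · rw [← hα]
        exact eventually_mem_nhdsWithin
      · exact nhdsWithin_le_nhds (isOpen_ne.mem_nhds hα)
    filter_upwards [hj] with x hx hx'
    apply hx
    linear_combination 2 * hx'
  have h2 : ∀ᶠ x in 𝓝[≠] α, x ≠ 0 := nhdsWithin_le_nhds (isOpen_ne.mem_nhds h0)
  filter_upwards [h1, h2] with x hx hx0
  exact (truncHyp_wellPoised p x n (fun j hj => hx j (Finset.mem_range.2 hj)) hx0).symm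

theorem wellPoised5F4_eq_sum (p : ℕ) [Fact p.Prime] (α : ℚ_[p]) (n : ℕ) (h0 : α ≠ 0) :
    wellPoised5F4 p α n =
      ∑ k ∈ Finset.range (n + 1), (α + 2 * (k : ℚ_[p])) / α *
        ((ascPochhammer ℚ_[p] k).eval α / (k.factorial : ℚ_[p])) ^ 4 :=
  (tendsto_truncHyp_wellPoised p α n h0).limUnder_eq

theorem wellPoised5F4_eq_truncHyp (p : ℕ) [Fact p.Prime] (α : ℚ_[p]) (n : ℕ) (h0 : α ≠ 0)
    (h : ∀ j < n, α / 2 + (j : ℚ_[p]) ≠ 0) :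
    wellPoised5F4 p α n = truncHyp ![α, 1 + α / 2, α, α, α] ![α / 2, 1, 1, 1] 1 n := by
  rw [wellPoised5F4_eq_sum p α n h0, truncHyp_wellPoised p α n h h0]

/-! Write `a = ⟨-α⟩_p` and `s = α + a = p α*`, so `α = s - a`. Put `X_k = (s-a)_k / k!`
(`pochRatio`) and `Y_k = (-a)_k / (1+s)_k` (`shiftedPochRatio`). The series times `α` is `∑ (α+2k)
X_k^4`, and `X^4 = X (X-Y)^3 + 3 X^3 Y - 3 X^2 Y^2 + X Y^3`.

The cubic error is `0` modulo `p^4`: `X - Y` is a multiple of `s`, which gives `s^3`, and the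
remaining sum vanishes modulo `p` because its summand is antisymmetric under `k ↦ a - k`
(`pow_four_dvd_sum_pochRatio`). Each of the other three sums is a terminating very well-poised `₅F₄`
with a closed form (`sum_wellPoisedTerm`, `sum_pochRatio_eq`).

With `E(x) = (1+x)_a` and `Q(x) = (1+a+x)_a`, these closed forms share the factor `α (1+α)_a`, a
multiple of `s`. The rest is therefore needed only modulo `p^3`, where a third-difference argument
(`Polynomial.cube_dvd_interpolation`) collapses it to `E(-2s) Q(-2s) / E(-s)^3 = (1-2s)_{2a} /
(1-s)_a^3`.

These products become values of `Γ_p` by its functional equation. What is left over is `Γ_p(-2s) ≡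
Γ_p(s) Γ_p(-s)^3`, which follows from `Γ_p(s) Γ_p(-s) = 1` and `Γ_p(2s) ≡ Γ_p(s)^2`, modulo `p^2` in
general and modulo `p^3` for `p ≥ 5`. The two cases of the theorem differ in whether `(1-2s)_{2a}`
contains the factor `p - 2s = p (1 - 2α*)`, which is divisible by `p`. -/

/-! ### The terminating very well-poised `₅F₄` summation. -/

/-- The `k`-th term of the terminating very well-poised `₅F₄` series, multiplied by the leading
parameter `A`. -/
noncomputable def wellPoisedTerm {K : Type*} [Field K] (A b c : K) (n k : ℕ) : K :=
  (A + 2 * k) * ((ascPochhammer K k).eval A * (ascPochhammer K k).eval b *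
    (ascPochhammer K k).eval c * (ascPochhammer K k).eval (-(n : K))) /
    ((k.factorial : K) * (ascPochhammer K k).eval (1 + A - b) *
      (ascPochhammer K k).eval (1 + A - c) * (ascPochhammer K k).eval (1 + A + n))

theorem ascPochhammer_succ_eval_left {R : Type*} [CommRing R] (k : ℕ) (x : R) :
    (ascPochhammer R (k + 1)).eval x = x * (ascPochhammer R k).eval (x + 1) := by
  rw [ascPochhammer_succ_left]
  simp [Polynomial.eval_comp]

theorem ascPochhammer_eval_eq_prod {R : Type*} [CommRing R] (k : ℕ) (x : R) :
    (ascPochhammer R k).eval x = ∏ i ∈ Finset.range k, (x + i) := by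
  induction k with
  | zero => simp
  | succ k ih => rw [ascPochhammer_succ_eval, Finset.prod_range_succ, ih]

theorem ascPochhammer_eval_ne_zero {K : Type*} [Field K] (k : ℕ) (x : K)
    (h : ∀ i < k, x + i ≠ 0) : (ascPochhammer K k).eval x ≠ 0 := by
  rw [ascPochhammer_eval_eq_prod, Finset.prod_ne_zero_iff]
  exact fun i hi => h i (Finset.mem_range.1 hi)

/-- Telescoping in `k` of the recurrence in `n` satisfied by the very well-poised series. -/
theorem sum_wellPoisedTerm_recurrence {K : Type*} [Field K] [CharZero K] (A b c : K) (n m : ℕ)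
    (hA : ∀ i ≤ m, 1 + A + n + i ≠ 0) (hb : ∀ i < m, 1 + A - b + i ≠ 0)
    (hc : ∀ i < m, 1 + A - c + i ≠ 0) :
    ∑ k ∈ Finset.range (m + 1),
      ((1 + A - b + n) * (1 + A - c + n) * wellPoisedTerm A b c (n + 1) k -
        (1 + A + n) * (1 + A - b - c + n) * wellPoisedTerm A b c n k) =
      (1 + A + n) * (A + m) * (b + m) * (c + m) / (1 + A + n + m) *
      (((ascPochhammer K m).eval A * (ascPochhammer K m).eval b *
        (ascPochhammer K m).eval c * (ascPochhammer K m).eval (-(n : K))) /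
      ((m.factorial : K) * (ascPochhammer K m).eval (1 + A - b) *
        (ascPochhammer K m).eval (1 + A - c) * (ascPochhammer K m).eval (1 + A + n))) := by
  -- The right side is a Wilf–Zeilberger certificate: its difference in `m` is the summand, a
  -- rational identity once the common Pochhammer values are generalized.
  induction m with
  | zero =>
    have h0 := hA 0 (by omega)
    simp only [Nat.cast_zero, add_zero] at h0
    simp [wellPoisedTerm]
    field_simp
    ring
  | succ m ih =>
    rw [Finset.sum_range_succ, ih (fun i hi => hA i (by omega)) (fun i hi => hb i (by omega))
      (fun i hi => hc i (by omega))]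
    have hx : ∀ k : ℕ, (∀ i : ℕ, i < k → 1 + A + n + i ≠ 0) →
        (ascPochhammer K k).eval (1 + A + (n : K)) ≠ 0 :=
      fun k h => ascPochhammer_eval_ne_zero _ _ h
    have n0 := hA 0 (by omega)
    have n1 := hA m (by omega)
    have n2 := hA (m + 1) (by omega)
    have n3 := hx m (fun i hi => hA i (by omega))
    have nb := hb m (by omega)
    have nc := hc m (by omega)
    have nb' := ascPochhammer_eval_ne_zero m (1 + A - b) (fun i hi => hb i (by omega))
    have nc' := ascPochhammer_eval_ne_zero m (1 + A - c) (fun i hi => hc i (by omega))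
    have hm : ((m : K) + 1) ≠ 0 := by exact_mod_cast Nat.succ_ne_zero m
    have hf : (m.factorial : K) ≠ 0 := by exact_mod_cast m.factorial_ne_zero
    have e1 : (ascPochhammer K (m + 1)).eval (-((n + 1 : ℕ) : K)) =
        -((n : K) + 1) * (ascPochhammer K m).eval (-(n : K)) := by
      rw [ascPochhammer_succ_eval_left]
      push_cast
      congr 2
      · ring
    have e2 : (ascPochhammer K (m + 1)).eval (1 + A + ((n + 1 : ℕ) : K)) =
        (ascPochhammer K m).eval (1 + A + n) * (1 + A + n + m) * (1 + A + n + (m + 1 : ℕ)) /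
          (1 + A + n) := by
      rw [eq_div_iff (by simpa using n0), ← ascPochhammer_succ_eval, ← ascPochhammer_succ_eval,
        ascPochhammer_succ_eval_left (m + 1), mul_comm]
      push_cast
      congr 2
      ring
    simp only [wellPoisedTerm, e1, e2]
    simp only [ascPochhammer_succ_eval, Nat.factorial_succ]
    push_cast at n0 n1 n2 ⊢
    rw [add_zero] at n0
    generalize (ascPochhammer K m).eval (-(n : K)) = X1
    generalize (ascPochhammer K m).eval A = X2
    generalize (ascPochhammer K m).eval b = X3
    generalize (ascPochhammer K m).eval c = X4
    generalize (ascPochhammer K m).eval (1 + A - b) = X5 at *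
    generalize (ascPochhammer K m).eval (1 + A - c) = X6 at *
    generalize (ascPochhammer K m).eval (1 + A + (n : K)) = X7 at *
    generalize (m.factorial : K) = X8 at *
    generalize (m : K) = M at *
    generalize (n : K) = N at *
    field_simp
    ring

/-- The terminating very well-poised `₅F₄` summation. -/
theorem sum_wellPoisedTerm {K : Type*} [Field K] [CharZero K] (A b c : K) (n : ℕ)
    (hA : ∀ i < 2 * n, 1 + A + i ≠ 0) (hb : ∀ i < n, 1 + A - b + i ≠ 0)
    (hc : ∀ i < n, 1 + A - c + i ≠ 0) :
    (∑ k ∈ Finset.range (n + 1), wellPoisedTerm A b c n k) *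
      ((ascPochhammer K n).eval (1 + A - b) * (ascPochhammer K n).eval (1 + A - c)) =
      A * (ascPochhammer K n).eval (1 + A) * (ascPochhammer K n).eval (1 + A - b - c) := by
  induction n with
  | zero => simp [wellPoisedTerm]
  | succ n ih =>
    have ih' := ih (fun i hi => hA i (by omega)) (fun i hi => hb i (by omega))
      (fun i hi => hc i (by omega))
    have hrec := sum_wellPoisedTerm_recurrence A b c n (n + 1)
      (fun i hi => by
        have := hA (n + i) (by omega)
        push_cast at this
        rwa [← add_assoc] at this) hb hc
    -- Summing up to `k = n + 1` kills the telescoped boundary term and leaves a first-order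
    -- recurrence in `n`.
    have hz : (ascPochhammer K (n + 1)).eval (-(n : K)) = 0 := by
      rw [ascPochhammer_succ_eval]; simp
    rw [hz, Finset.sum_sub_distrib, ← Finset.mul_sum, ← Finset.mul_sum] at hrec
    have hlast : wellPoisedTerm A b c n (n + 1) = 0 := by simp [wellPoisedTerm, hz]
    rw [Finset.sum_range_succ (fun k => wellPoisedTerm A b c n k) (n + 1), hlast] at hrec
    simp only [ascPochhammer_succ_eval]
    generalize ∑ k ∈ Finset.range (n + 1 + 1), wellPoisedTerm A b c (n + 1) k = S' at *
    generalize ∑ k ∈ Finset.range (n + 1), wellPoisedTerm A b c n k = S at *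
    generalize (ascPochhammer K n).eval (1 + A - b) = X1 at *
    generalize (ascPochhammer K n).eval (1 + A - c) = X2 at *
    linear_combination X1 * X2 * hrec + (1 + A + n) * (1 + A - b - c + n) * ih'

/-! ### Existence, continuity and functional equation of `Γ_p`. -/

section Gamma

variable {p : ℕ} [Fact p.Prime]

theorem PadicInt.pow_dvd_iff_norm_le (x : ℤ_[p]) (n : ℕ) :
    (p : ℤ_[p]) ^ n ∣ x ↔ ‖x‖ ≤ (p : ℝ) ^ (-n : ℤ) := by
  rw [PadicInt.norm_le_pow_iff_mem_span_pow, Ideal.mem_span_singleton]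

theorem PadicInt.isUnit_iff_not_prime_dvd (x : ℤ_[p]) : IsUnit x ↔ ¬ (p : ℤ_[p]) ∣ x := by
  rw [PadicInt.isUnit_iff, ← PadicInt.norm_lt_one_iff_dvd, not_lt]
  exact ⟨fun h => h.ge, fun h => le_antisymm (PadicInt.norm_le_one x) h⟩

theorem PadicInt.prime_dvd_natCast (k : ℕ) : (p : ℤ_[p]) ∣ (k : ℤ_[p]) ↔ p ∣ k := by
  rw [← PadicInt.norm_lt_one_iff_dvd]
  have := PadicInt.norm_int_lt_one_iff_dvd (p := p) (k : ℤ)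
  rw [Int.cast_natCast] at this
  rw [this, Int.natCast_dvd_natCast]

theorem PadicInt.pow_dvd_intCast (N : ℕ) (k : ℤ) :
    (p : ℤ_[p]) ^ N ∣ (k : ℤ_[p]) ↔ (p : ℤ) ^ N ∣ k := by
  rw [PadicInt.pow_dvd_iff_norm_le, PadicInt.norm_int_le_pow_iff_dvd]

/-- `x` if `x` is a `p`-adic unit, and `1` otherwise. -/
noncomputable def unitPart (p : ℕ) [Fact p.Prime] (x : ℤ_[p]) : ℤ_[p] :=
  open Classical in if (p : ℤ_[p]) ∣ x then 1 else x

theorem unitPart_of_dvd {x : ℤ_[p]} (h : (p : ℤ_[p]) ∣ x) : unitPart p x = 1 := if_pos h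

theorem unitPart_of_not_dvd {x : ℤ_[p]} (h : ¬ (p : ℤ_[p]) ∣ x) : unitPart p x = x := if_neg h

theorem isUnit_unitPart (x : ℤ_[p]) : IsUnit (unitPart p x) := by
  by_cases h : (p : ℤ_[p]) ∣ x
  · rw [unitPart_of_dvd h]; exact isUnit_one
  · rw [unitPart_of_not_dvd h, PadicInt.isUnit_iff_not_prime_dvd]; exact h

theorem pow_dvd_unitPart_sub {N : ℕ} (hN : N ≠ 0) {x y : ℤ_[p]} (h : (p : ℤ_[p]) ^ N ∣ x - y) :
    (p : ℤ_[p]) ^ N ∣ unitPart p x - unitPart p y := by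
  have h1 : (p : ℤ_[p]) ∣ x - y := (dvd_pow_self _ hN).trans h
  by_cases hx : (p : ℤ_[p]) ∣ x
  · rw [unitPart_of_dvd hx, unitPart_of_dvd ((dvd_iff_dvd_of_dvd_sub h1).1 hx)]; simp
  · rw [unitPart_of_not_dvd hx, unitPart_of_not_dvd (mt (dvd_iff_dvd_of_dvd_sub h1).2 hx)]
    exact h

theorem pow_dvd_mul_sub_mul {R : Type*} [CommRing R] {d x y z w : R} (h : d ∣ x - y)
    (h' : d ∣ z - w) : d ∣ x * z - y * w := by
  have : x * z - y * w = (x - y) * z + y * (z - w) := by ring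
  rw [this]
  exact dvd_add (h.mul_right _) (h'.mul_left _)

theorem padicGammaNat_zero (q : ℕ) : padicGammaNat q 0 = 1 := by simp [padicGammaNat]

theorem padicGammaNat_succ (n : ℕ) :
    ((padicGammaNat p (n + 1) : ℤ) : ℤ_[p]) =
      -unitPart p (n : ℤ_[p]) * ((padicGammaNat p n : ℤ) : ℤ_[p]) := by
  rcases Nat.eq_zero_or_pos n with rfl | hn
  · rw [unitPart_of_dvd (by simp)]
    simp [padicGammaNat]
  · have hI : Finset.Ico 1 (n + 1) = insert n (Finset.Ico 1 n) := by
      ext k; simp; omega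
    by_cases h : p ∣ n
    · rw [unitPart_of_dvd ((PadicInt.prime_dvd_natCast n).2 h)]
      simp only [padicGammaNat, hI, Finset.filter_insert, h, not_true_eq_false, if_false, pow_succ]
      push_cast; ring
    · rw [unitPart_of_not_dvd (mt (PadicInt.prime_dvd_natCast n).1 h)]
      simp only [padicGammaNat, hI, Finset.filter_insert, h, not_false_eq_true, if_true, pow_succ]
      rw [Finset.prod_insert (by simp)]
      push_cast; ring

theorem ZMod.eq_one_or_neg_one_of_mul_self (hp : p ≠ 2) (N : ℕ) (x : ZMod (p ^ N))
    (h : x * x = 1) : x = 1 ∨ x = -1 := by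
  obtain ⟨k, rfl⟩ := ZMod.intCast_surjective x
  have hpr : Nat.Prime p := Fact.out
  have h1 : ((p ^ N : ℕ) : ℤ) ∣ (k - 1) * (k + 1) := by
    rw [← ZMod.intCast_zmod_eq_zero_iff_dvd]
    push_cast
    linear_combination h
  have hP : Prime (p : ℤ) := Nat.prime_iff_prime_int.1 hpr
  have e1 : (k : ZMod (p ^ N)) = 1 ↔ ((p ^ N : ℕ) : ℤ) ∣ k - 1 := by
    rw [← ZMod.intCast_zmod_eq_zero_iff_dvd]; push_cast; rw [sub_eq_zero]
  have e2 : (k : ZMod (p ^ N)) = -1 ↔ ((p ^ N : ℕ) : ℤ) ∣ k + 1 := by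
    rw [← ZMod.intCast_zmod_eq_zero_iff_dvd]; push_cast; rw [eq_neg_iff_add_eq_zero]
  rw [e1, e2]
  push_cast at h1 ⊢
  by_cases hk : (p : ℤ) ∣ k - 1
  · left
    refine (IsCoprime.pow_left ?_).dvd_of_dvd_mul_right h1
    rw [hP.coprime_iff_not_dvd]
    intro h2
    have : (p : ℤ) ∣ 2 := by
      have := dvd_sub h2 hk
      ring_nf at this
      exact this
    have h3 : p ∣ 2 := by exact_mod_cast this
    exact hp ((Nat.prime_dvd_prime_iff_eq hpr Nat.prime_two).1 h3)
  · right
    refine (IsCoprime.pow_left ?_).dvd_of_dvd_mul_left h1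
    rwa [hP.coprime_iff_not_dvd]

theorem ZMod.prod_units_prime_pow (hp : p ≠ 2) (N : ℕ) :
    ∏ u : (ZMod (p ^ N))ˣ, u = -1 := by
  classical
  -- Pair each unit with its inverse: once `-1` is removed, `1` is the only self-inverse unit.
  have : (∏ x ∈ (Finset.univ : Finset (ZMod (p ^ N))ˣ).erase (-1), x) = 1 := by
    refine Finset.prod_involution (fun x _ => x⁻¹) (by simp) (fun a ha h1 h2 => ?_)
      (fun a => by simp [@inv_eq_iff_eq_inv _ _ a]) (by simp)
    have h3 : a * a = 1 := by
      nth_rewrite 1 [← h2]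
      simp
    rcases ZMod.eq_one_or_neg_one_of_mul_self hp N (a : ZMod (p ^ N))
      (by rw [← Units.val_mul, h3, Units.val_one]) with h | h
    · exact h1 (Units.ext h)
    · exact (Finset.ne_of_mem_erase ha) (Units.ext h)
  rw [← Finset.insert_erase (Finset.mem_univ (-1 : (ZMod (p ^ N))ˣ)),
    Finset.prod_insert (Finset.notMem_erase _ _), this, mul_one]

/-- Wilson's theorem modulo `p^N`: the units multiply to `-1`, and the sign `(-1)^(p^N)` is `-1` as
well. -/
theorem pow_dvd_padicGammaNat_pow_sub_one (hp : p ≠ 2) {N : ℕ} (hN : N ≠ 0) :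
    (p : ℤ_[p]) ^ N ∣ ((padicGammaNat p (p ^ N) : ℤ) : ℤ_[p]) - 1 := by
  have hpr : Nat.Prime p := Fact.out
  have hodd : Odd p := hpr.odd_of_ne_two hp
  have : ((padicGammaNat p (p ^ N) : ℤ) : ZMod (p ^ N)) = 1 := by
    have h := congrArg Units.val (ZMod.prod_units_prime_pow hp N)
    rw [Units.coe_prod] at h
    rw [padicGammaNat, hodd.pow.neg_one_pow]
    push_cast
    have hh : ∏ k ∈ (Finset.Ico 1 (p ^ N)).filter (fun k => ¬ p ∣ k), (k : ZMod (p ^ N)) =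
        ∏ u : (ZMod (p ^ N))ˣ, (u : ZMod (p ^ N)) := by
      symm
      have hc : ∀ u : (ZMod (p ^ N))ˣ, ¬ p ∣ (u : ZMod (p ^ N)).val := fun u hu => by
        have := ZMod.val_coe_unit_coprime u
        exact hpr.one_lt.ne' (Nat.dvd_one.1 (this ▸ Nat.dvd_gcd hu (dvd_pow_self p hN)))
      refine Finset.prod_bij (fun u _ => (u : ZMod (p ^ N)).val) ?_ ?_ ?_ ?_
      · intro u _
        rw [Finset.mem_filter, Finset.mem_Ico]
        refine ⟨⟨Nat.one_le_iff_ne_zero.2 fun h0 => hc u (by simp [h0]), ZMod.val_lt _⟩, hc u⟩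
      · intro u _ v _ huv
        exact Units.ext (ZMod.val_injective _ huv)
      · intro k hk
        rw [Finset.mem_filter, Finset.mem_Ico] at hk
        have hco : Nat.Coprime k (p ^ N) :=
          Nat.Coprime.pow_right _ ((Nat.coprime_comm).1 ((Nat.Prime.coprime_iff_not_dvd hpr).2 hk.2))
        refine ⟨ZMod.unitOfCoprime k hco, Finset.mem_univ _, ?_⟩
        rw [ZMod.coe_unitOfCoprime, ZMod.val_natCast, Nat.mod_eq_of_lt hk.1.2]
      · intro u _
        simp
    rw [hh, h]
    simp
  have h2 : (p : ℤ) ^ N ∣ padicGammaNat p (p ^ N) - 1 := by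
    have := (ZMod.intCast_zmod_eq_zero_iff_dvd (padicGammaNat p (p ^ N) - 1) (p ^ N)).1
      (by push_cast; rw [this, sub_self])
    exact_mod_cast this
  have := (PadicInt.pow_dvd_intCast (p := p) N _).2 h2
  push_cast at this
  exact this

theorem pow_dvd_padicGammaNat_add_pow_sub (hp : p ≠ 2) {N : ℕ} (hN : N ≠ 0) (n : ℕ) :
    (p : ℤ_[p]) ^ N ∣
      ((padicGammaNat p (n + p ^ N) : ℤ) : ℤ_[p]) - ((padicGammaNat p n : ℤ) : ℤ_[p]) := by
  induction n with
  | zero =>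
    rw [padicGammaNat_zero, zero_add]
    exact_mod_cast pow_dvd_padicGammaNat_pow_sub_one hp hN
  | succ n ih =>
    rw [add_right_comm, padicGammaNat_succ, padicGammaNat_succ]
    refine pow_dvd_mul_sub_mul ?_ ih
    rw [← neg_sub_neg, neg_neg, neg_neg]
    refine pow_dvd_unitPart_sub hN ?_
    push_cast
    rw [← dvd_neg]
    simp

theorem pow_dvd_padicGammaNat_sub (hp : p ≠ 2) {N : ℕ} (hN : N ≠ 0) {m n : ℕ}
    (h : (p : ℤ_[p]) ^ N ∣ (m : ℤ_[p]) - n) :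
    (p : ℤ_[p]) ^ N ∣
      ((padicGammaNat p m : ℤ) : ℤ_[p]) - ((padicGammaNat p n : ℤ) : ℤ_[p]) := by
  wlog hmn : n ≤ m generalizing m n
  · rw [← dvd_neg, neg_sub] at h ⊢
    exact this h (by omega)
  have h' : (p : ℤ) ^ N ∣ (m : ℤ) - n := by
    rw [← PadicInt.pow_dvd_intCast]; push_cast; exact h
  obtain ⟨q, hq⟩ : p ^ N ∣ m - n := by
    rw [← Int.natCast_dvd_natCast]
    push_cast [Nat.cast_sub hmn]
    exact h'
  obtain rfl : m = n + p ^ N * q := by omega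
  clear h h' hq hmn
  induction q with
  | zero => simp
  | succ q ih =>
    rw [mul_add, mul_one, ← add_assoc]
    have := dvd_add (pow_dvd_padicGammaNat_add_pow_sub hp hN (n + p ^ N * q)) ih
    rwa [sub_add_sub_cancel] at this

theorem tendsto_padicGammaNat (hp : p ≠ 2) (x : ℤ_[p]) :
    Tendsto (fun n : ℕ => ((padicGammaNat p n : ℤ) : ℤ_[p]))
      (comap (fun n : ℕ => (n : ℤ_[p])) (𝓝 x)) (𝓝 (padicGamma p x)) := by
  -- The filter of naturals tending to `x` is nontrivial because `ℕ` is dense in `ℤ_[p]`.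
  have hne : NeBot (comap (fun n : ℕ => (n : ℤ_[p])) (𝓝 x)) :=
    comap_neBot fun _ hs => by
      rcases mem_closure_iff_nhds.1 (PadicInt.denseRange_natCast x) _ hs with ⟨_, ha, n, rfl⟩
      exact ⟨n, ha⟩
  refine tendsto_nhds_limUnder ?_
  refine cauchy_map_iff_exists_tendsto.1 ?_
  rw [Metric.cauchy_iff]
  refine ⟨hne.map _, fun ε hε => ?_⟩
  obtain ⟨N, hN⟩ := PadicInt.exists_pow_neg_lt p hε
  refine ⟨_, image_mem_map (preimage_mem_comap
    (Metric.closedBall_mem_nhds x (ε := (p : ℝ) ^ (-((N + 1 : ℕ)) : ℤ))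
      (zpow_pos (by exact_mod_cast (Fact.out : Nat.Prime p).pos) _))), ?_⟩
  rintro _ ⟨m, hm, rfl⟩ _ ⟨n, hn, rfl⟩
  rw [Set.mem_preimage, Metric.mem_closedBall, dist_eq_norm, ← PadicInt.pow_dvd_iff_norm_le] at hm hn
  have h1 := dvd_sub hm hn
  rw [sub_sub_sub_cancel_right] at h1
  have h2 := (pow_dvd_pow _ (Nat.le_succ N)).trans
    (pow_dvd_padicGammaNat_sub hp (Nat.succ_ne_zero N) h1)
  rw [PadicInt.pow_dvd_iff_norm_le] at h2
  rw [dist_eq_norm]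
  exact h2.trans_lt hN

/-- Quantitative continuity: it transfers statements about `padicGammaNat` to `padicGamma` one power
of `p` at a time. -/
theorem pow_dvd_padicGamma_sub_nat (hp : p ≠ 2) {N : ℕ} (hN : N ≠ 0) {x : ℤ_[p]} {n : ℕ}
    (h : (p : ℤ_[p]) ^ N ∣ x - n) :
    (p : ℤ_[p]) ^ N ∣ padicGamma p x - ((padicGammaNat p n : ℤ) : ℤ_[p]) := by
  have hne : NeBot (comap (fun n : ℕ => (n : ℤ_[p])) (𝓝 x)) :=
    comap_neBot fun _ hs => by
      rcases mem_closure_iff_nhds.1 (PadicInt.denseRange_natCast x) _ hs with ⟨_, ha, n, rfl⟩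
      exact ⟨n, ha⟩
  rw [PadicInt.pow_dvd_iff_norm_le, ← dist_eq_norm, ← Metric.mem_closedBall]
  refine Metric.isClosed_closedBall.mem_of_tendsto (tendsto_padicGammaNat hp x) ?_
  filter_upwards [preimage_mem_comap
    (Metric.closedBall_mem_nhds x (ε := (p : ℝ) ^ (-(N : ℤ)))
      (zpow_pos (by exact_mod_cast (Fact.out : Nat.Prime p).pos) _))] with m hm
  rw [Set.mem_preimage, Metric.mem_closedBall, dist_eq_norm, ← PadicInt.pow_dvd_iff_norm_le] at hm
  rw [Metric.mem_closedBall, dist_eq_norm, ← PadicInt.pow_dvd_iff_norm_le]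
  refine pow_dvd_padicGammaNat_sub hp hN ?_
  have := dvd_add hm h
  rwa [sub_add_sub_cancel] at this

theorem PadicInt.exists_nat_pow_dvd_sub (x : ℤ_[p]) (N : ℕ) :
    ∃ n : ℕ, (p : ℤ_[p]) ^ N ∣ x - n :=
  ⟨_, Ideal.mem_span_singleton.1 (PadicInt.appr_spec N x)⟩

theorem PadicInt.eq_of_forall_pow_dvd_sub {x y : ℤ_[p]}
    (h : ∀ N : ℕ, N ≠ 0 → (p : ℤ_[p]) ^ N ∣ x - y) : x = y := by
  rw [← PadicInt.ext_of_toZModPow]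
  intro N
  rw [← sub_eq_zero, ← map_sub, ← RingHom.mem_ker, PadicInt.ker_toZModPow,
    Ideal.mem_span_singleton]
  exact (pow_dvd_pow _ (Nat.le_succ N)).trans (h (N + 1) (Nat.succ_ne_zero N))

theorem padicGamma_add_one (hp : p ≠ 2) (x : ℤ_[p]) :
    padicGamma p (x + 1) = -unitPart p x * padicGamma p x := by
  refine PadicInt.eq_of_forall_pow_dvd_sub fun N hN => ?_
  obtain ⟨n, hn⟩ := PadicInt.exists_nat_pow_dvd_sub x N
  have h1 := pow_dvd_padicGamma_sub_nat hp hN (x := x + 1) (n := n + 1)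
    (by push_cast; rwa [add_sub_add_right_eq_sub])
  have h2 := pow_dvd_padicGamma_sub_nat hp hN hn
  have h3 := pow_dvd_mul_sub_mul (pow_dvd_unitPart_sub hN hn) h2
  rw [padicGammaNat_succ] at h1
  have := dvd_add h1 h3
  convert this using 1
  ring

theorem padicGamma_zero (hp : p ≠ 2) : padicGamma p (0 : ℤ_[p]) = 1 := by
  refine PadicInt.eq_of_forall_pow_dvd_sub fun N hN => ?_
  have := pow_dvd_padicGamma_sub_nat hp hN (x := (0 : ℤ_[p])) (n := 0) (by simp)
  rwa [padicGammaNat_zero, Int.cast_one] at this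

theorem padicGamma_add_nat (hp : p ≠ 2) (x : ℤ_[p]) (n : ℕ) :
    padicGamma p (x + n) =
      (-1) ^ n * (∏ j ∈ Finset.range n, unitPart p (x + (j : ℤ_[p]))) * padicGamma p x := by
  induction n with
  | zero => simp
  | succ n ih =>
    rw [Nat.cast_succ, ← add_assoc, padicGamma_add_one hp, ih, Finset.prod_range_succ]
    ring

theorem padicGamma_nat (hp : p ≠ 2) (n : ℕ) :
    padicGamma p (n : ℤ_[p]) = (-1) ^ n * ∏ j ∈ Finset.range n, unitPart p (j : ℤ_[p]) := by
  have := padicGamma_add_nat hp 0 n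
  simpa [padicGamma_zero hp] using this

theorem pow_dvd_padicGamma_sub (hp : p ≠ 2) {N : ℕ} (hN : N ≠ 0) {x y : ℤ_[p]}
    (h : (p : ℤ_[p]) ^ N ∣ x - y) : (p : ℤ_[p]) ^ N ∣ padicGamma p x - padicGamma p y := by
  obtain ⟨n, hn⟩ := PadicInt.exists_nat_pow_dvd_sub y N
  have h1 := pow_dvd_padicGamma_sub_nat hp hN hn
  have h2 := pow_dvd_padicGamma_sub_nat hp hN (x := x) (n := n) (by
    have := dvd_add h hn
    rwa [sub_add_sub_cancel] at this)
  have := dvd_sub h2 h1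
  rwa [sub_sub_sub_cancel_right] at this

theorem isUnit_padicGamma (hp : p ≠ 2) (x : ℤ_[p]) : IsUnit (padicGamma p x) := by
  obtain ⟨n, hn⟩ := PadicInt.exists_nat_pow_dvd_sub x 1
  have h := pow_dvd_padicGamma_sub hp one_ne_zero hn
  rw [pow_one] at h
  rw [PadicInt.isUnit_iff_not_prime_dvd, dvd_iff_dvd_of_dvd_sub h,
    ← PadicInt.isUnit_iff_not_prime_dvd, padicGamma_nat hp]
  refine ((isUnit_one.neg).pow n).mul ?_
  exact IsUnit.prod_iff.2 fun j _ => isUnit_unitPart _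

end Gamma

/-! ### Values of `Γ_p` at multiples of `p`: reflection and duplication. -/

section GammaMultiples

variable {p : ℕ} [Fact p.Prime]

theorem PadicInt.not_prime_dvd_two (hp : p ≠ 2) : ¬ (p : ℤ_[p]) ∣ 2 := by
  have h := PadicInt.prime_dvd_natCast (p := p) 2
  rw [Nat.cast_ofNat] at h
  rw [h, Nat.prime_dvd_prime_iff_eq Fact.out Nat.prime_two]
  exact hp

/-- If `x² ≡ y² (mod p^N)`, `x ≡ y (mod p)` and `y` is a unit, then `x ≡ y (mod p^N)`. -/
theorem PadicInt.pow_dvd_sub_of_sq (hp : p ≠ 2) {x y : ℤ_[p]} (hy : IsUnit y)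
    (h1 : (p : ℤ_[p]) ∣ x - y) {N : ℕ} (h2 : (p : ℤ_[p]) ^ N ∣ x * x - y * y) :
    (p : ℤ_[p]) ^ N ∣ x - y := by
  -- Modulo `p` this sum is `2y`, a unit since `p` is odd.
  have hu : IsUnit (x + y) := by
    rw [PadicInt.isUnit_iff_not_prime_dvd] at hy ⊢
    intro h
    have h3 : (p : ℤ_[p]) ∣ 2 * y := by
      have := dvd_sub h h1
      ring_nf at this
      rwa [mul_comm] at this
    rcases PadicInt.prime_p.dvd_or_dvd h3 with h4 | h4
    · exact PadicInt.not_prime_dvd_two hp h4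
    · exact hy h4
  rw [show x * x - y * y = (x - y) * (x + y) by ring] at h2
  exact (hu.dvd_mul_right).1 h2

theorem unitPart_neg_mul_self (x : ℤ_[p]) :
    unitPart p (-x) * unitPart p (-x) = unitPart p x * unitPart p x := by
  by_cases h : (p : ℤ_[p]) ∣ x
  · rw [unitPart_of_dvd h, unitPart_of_dvd (by simpa using h)]
  · rw [unitPart_of_not_dvd h, unitPart_of_not_dvd (by simpa using h)]
    ring

/-- The factors at `j = 0` and `j = n` are both `1`, so the index range can be shifted by one and
then reversed. -/
theorem prod_unitPart_reflect {n : ℕ} {x : ℤ_[p]} (hn : p ∣ n) (hx : (p : ℤ_[p]) ∣ x) :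
    ∏ j ∈ Finset.range n, unitPart p (x + (j : ℤ_[p])) =
      ∏ j ∈ Finset.range n, unitPart p (x + (n : ℤ_[p]) - j) := by
  have hn' : (p : ℤ_[p]) ∣ n := (PadicInt.prime_dvd_natCast n).2 hn
  have h1 : ∏ j ∈ Finset.range n, unitPart p (x + (j : ℤ_[p])) =
      ∏ j ∈ Finset.range n, unitPart p (x + ((j + 1 : ℕ) : ℤ_[p])) := by
    have e1 := Finset.prod_range_succ (fun j : ℕ => unitPart p (x + (j : ℤ_[p]))) n
    have e2 := Finset.prod_range_succ' (fun j : ℕ => unitPart p (x + (j : ℤ_[p]))) n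
    rw [unitPart_of_dvd (dvd_add hx hn'), mul_one] at e1
    rw [unitPart_of_dvd (by simpa using hx), mul_one] at e2
    rw [← e1, e2]
  rw [h1, ← Finset.prod_range_reflect]
  refine Finset.prod_congr rfl fun j hj => ?_
  have hj' := Finset.mem_range.1 hj
  congr 1
  rw [show n - 1 - j + 1 = n - j by omega, Nat.cast_sub hj'.le]
  ring

/-- Up to sign, both factors come from the product of the unit parts of `j` or of `-j`. Comparing
squares avoids tracking signs; the root is then fixed by the value modulo `p`. -/
theorem padicGamma_mul_neg_nat (hp : p ≠ 2) {n : ℕ} (hn : p ∣ n) :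
    padicGamma p (n : ℤ_[p]) * padicGamma p (-(n : ℤ_[p])) = 1 := by
  have hn' : (p : ℤ_[p]) ∣ n := (PadicInt.prime_dvd_natCast n).2 hn
  have hΓ : ∀ x : ℤ_[p], (p : ℤ_[p]) ∣ x → (p : ℤ_[p]) ∣ padicGamma p x - 1 := fun x hx => by
    have := pow_dvd_padicGamma_sub hp one_ne_zero (x := x) (y := 0) (by simpa using hx)
    rwa [padicGamma_zero hp, pow_one] at this
  have h1 := padicGamma_add_nat hp (-(n : ℤ_[p])) n
  rw [neg_add_cancel, padicGamma_zero hp, prod_unitPart_reflect hn (by simpa using hn')] at h1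
  have h2 := padicGamma_nat hp n
  have h3 : (∏ j ∈ Finset.range n, unitPart p (-(n : ℤ_[p]) + n - j)) *
      ∏ j ∈ Finset.range n, unitPart p (-(n : ℤ_[p]) + n - j) =
      (∏ j ∈ Finset.range n, unitPart p (j : ℤ_[p])) *
        ∏ j ∈ Finset.range n, unitPart p (j : ℤ_[p]) := by
    rw [← Finset.prod_mul_distrib, ← Finset.prod_mul_distrib]
    refine Finset.prod_congr rfl fun j _ => ?_
    rw [neg_add_cancel, zero_sub, unitPart_neg_mul_self]
  have hsq : ((-1 : ℤ_[p]) ^ n) * (-1) ^ n = 1 := by rw [← mul_pow]; simp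
  refine PadicInt.eq_of_forall_pow_dvd_sub fun N _ => ?_
  refine PadicInt.pow_dvd_sub_of_sq hp isUnit_one ?_ ?_
  · have := pow_dvd_mul_sub_mul (hΓ _ hn') (hΓ _ (by simpa using hn' : (p : ℤ_[p]) ∣ -(n : ℤ_[p])))
    simpa using this
  · have : padicGamma p (n : ℤ_[p]) * padicGamma p (-(n : ℤ_[p])) *
      (padicGamma p (n : ℤ_[p]) * padicGamma p (-(n : ℤ_[p]))) - 1 * 1 = 0 := by
      rw [h2]
      generalize padicGamma p (-(n : ℤ_[p])) = g at *
      generalize ∏ j ∈ Finset.range n, unitPart p (-(n : ℤ_[p]) + n - j) = P at *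
      generalize ∏ j ∈ Finset.range n, unitPart p (j : ℤ_[p]) = Q at *
      generalize (-1 : ℤ_[p]) ^ n = e at *
      linear_combination (-e * e * g * g) * h3 - (e * P * g + 1) * h1
    rw [this]
    exact dvd_zero _

theorem PadicInt.dvd_of_dvd_sub_natCast {N : ℕ} (hN : N ≠ 0) {s : ℤ_[p]} (hs : (p : ℤ_[p]) ∣ s)
    {n : ℕ} (h : (p : ℤ_[p]) ^ N ∣ s - n) : p ∣ n := by
  rw [← PadicInt.prime_dvd_natCast, ← dvd_iff_dvd_of_dvd_sub ((dvd_pow_self _ hN).trans h)]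
  exact hs

theorem padicGamma_mul_neg (hp : p ≠ 2) {s : ℤ_[p]} (hs : (p : ℤ_[p]) ∣ s) :
    padicGamma p s * padicGamma p (-s) = 1 := by
  refine PadicInt.eq_of_forall_pow_dvd_sub fun N hN => ?_
  obtain ⟨n, hn⟩ := PadicInt.exists_nat_pow_dvd_sub s N
  rw [← padicGamma_mul_neg_nat hp (PadicInt.dvd_of_dvd_sub_natCast hN hs hn)]
  refine pow_dvd_mul_sub_mul (pow_dvd_padicGamma_sub hp hN hn) (pow_dvd_padicGamma_sub hp hN ?_)
  rw [← dvd_neg]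
  convert hn using 1
  ring

theorem ZMod.sum_range_natCast {M : Type*} [AddCommMonoid M] (f : ZMod p → M) :
    ∑ j ∈ Finset.range p, f (j : ZMod p) = ∑ x, f x := by
  refine Finset.sum_bij' (fun j _ => (j : ZMod p)) (fun x _ => x.val) ?_ ?_ ?_ ?_ ?_
  · simp
  · intro x _
    exact Finset.mem_range.2 (ZMod.val_lt x)
  · intro j hj
    exact ZMod.val_natCast_of_lt (Finset.mem_range.1 hj)
  · intro x _
    simp
  · simp

theorem ZMod.sum_range_mul_natCast {M : Type*} [AddCommMonoid M] (f : ZMod p → M) (m : ℕ) :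
    ∑ j ∈ Finset.range (p * m), f (j : ZMod p) = m • ∑ x, f x := by
  induction m with
  | zero => simp
  | succ m ih =>
    rw [mul_add, mul_one, Finset.sum_range_add, ih, succ_nsmul, ← ZMod.sum_range_natCast]
    simp

/-- Inversion permutes `ZMod p` (with `0⁻¹ = 0`), leaving a power sum of exponent `2 < p - 1`. This
fails for `p = 3`, where the sum is `2`. -/
theorem ZMod.sum_inv_sq (hp : 5 ≤ p) : ∑ x : ZMod p, x⁻¹ ^ 2 = 0 := by
  rw [Fintype.sum_equiv (Equiv.inv (ZMod p)) (fun x => x⁻¹ ^ 2) (fun x => x ^ 2) (by simp)]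
  exact FiniteField.sum_pow_lt_card_sub_one _ 2 (by rw [ZMod.card]; omega)

theorem prod_one_add_mul_eq {R ι : Type*} [CommRing R] (t : Finset ι) (e : R) (z : ι → R) :
    ∃ r, ∏ j ∈ t, (1 + e * z j) = 1 + e * ∑ j ∈ t, z j + e ^ 2 * r := by
  classical
  induction t using Finset.induction_on with
  | empty => exact ⟨0, by simp⟩
  | insert a t ha ih =>
    obtain ⟨r, hr⟩ := ih
    refine ⟨r * (1 + e * z a) + z a * ∑ j ∈ t, z j, ?_⟩
    rw [Finset.prod_insert ha, hr, Finset.sum_insert ha]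
    ring

/-- From `(n+j)(2n-j) = j(n-j) + 2n²`: take `z = 1/(j(n-j)) ≡ -1/j²`. When `p ∣ j` all unit parts
are `1` and `z = 0` agrees with `0⁻¹ = 0`. -/
theorem unitPart_mul_shift (n : ℤ_[p]) (hn : (p : ℤ_[p]) ∣ n) (j : ℕ) :
    ∃ z : ℤ_[p], unitPart p (n + j) * unitPart p (n + n - j) =
      unitPart p (j : ℤ_[p]) * unitPart p (n - j) * (1 + 2 * n ^ 2 * z) ∧
      PadicInt.toZMod z = -((j : ZMod p)⁻¹ ^ 2) := by
  have hz : ∀ x : ℤ_[p], (p : ℤ_[p]) ∣ x ↔ PadicInt.toZMod x = 0 := fun x => by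
    rw [← RingHom.mem_ker, PadicInt.ker_toZMod, PadicInt.maximalIdeal_eq_span_p,
      Ideal.mem_span_singleton]
  by_cases h : (p : ℤ_[p]) ∣ (j : ℤ_[p])
  · refine ⟨0, ?_, ?_⟩
    · rw [unitPart_of_dvd h, unitPart_of_dvd (dvd_add hn h),
        unitPart_of_dvd (dvd_sub (dvd_add hn hn) h), unitPart_of_dvd (dvd_sub hn h)]
      ring
    · rw [hz, map_natCast] at h
      simp [h]
  · have h1 : ¬ (p : ℤ_[p]) ∣ n - j := fun h' => h ((dvd_iff_dvd_of_dvd_sub h').1 hn)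
    have h2 : ¬ (p : ℤ_[p]) ∣ n + j := fun h' => h ((dvd_add_right hn).1 h')
    have h3 : ¬ (p : ℤ_[p]) ∣ n + n - j :=
      fun h' => h ((dvd_iff_dvd_of_dvd_sub h').1 (dvd_add hn hn))
    rw [unitPart_of_not_dvd h, unitPart_of_not_dvd h1, unitPart_of_not_dvd h2,
      unitPart_of_not_dvd h3]
    have hu : IsUnit ((j : ℤ_[p]) * (n - j)) :=
      ((PadicInt.isUnit_iff_not_prime_dvd _).2 h).mul ((PadicInt.isUnit_iff_not_prime_dvd _).2 h1)
    obtain ⟨z, hz1⟩ := hu.exists_right_inv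
    refine ⟨z, ?_, ?_⟩
    · linear_combination (-2 * n ^ 2) * hz1
    · have h4 := congrArg PadicInt.toZMod hz1
      have hn0 := (hz n).1 hn
      have hj0 : (j : ZMod p) ≠ 0 := fun h0 => h ((hz _).2 (by rw [map_natCast, h0]))
      simp only [map_mul, map_sub, map_natCast, map_one, hn0] at h4
      field_simp
      linear_combination -h4

/-- Here `Γ_p(2n) / Γ_p(n) = ±X` and `Γ_p(n) = ±Y` with the same sign. Pairing `j` with `n - j`
gives `X² / Y² = ∏ (1 + 2n² z_j)`. The factor `n²` yields `p²`; for `p ≥ 5` the sum of the `z_j`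
vanishes modulo `p` and yields the third power. -/
theorem pow_dvd_padicGamma_nat_add_self_sub_sq (hp : p ≠ 2) {n : ℕ} (hn : p ∣ n) {N : ℕ}
    (hN : N = 2 ∨ (N = 3 ∧ 5 ≤ p)) :
    (p : ℤ_[p]) ^ N ∣ padicGamma p ((n : ℤ_[p]) + n) - padicGamma p (n : ℤ_[p]) ^ 2 := by
  have hn' : (p : ℤ_[p]) ∣ n := (PadicInt.prime_dvd_natCast n).2 hn
  set X := ∏ j ∈ Finset.range n, unitPart p ((n : ℤ_[p]) + j) with hX
  set Y := ∏ j ∈ Finset.range n, unitPart p (j : ℤ_[p]) with hY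
  have hX2 : X = ∏ j ∈ Finset.range n, unitPart p ((n : ℤ_[p]) + n - j) :=
    prod_unitPart_reflect hn hn'
  have hY2 : Y = ∏ j ∈ Finset.range n, unitPart p ((n : ℤ_[p]) - j) := by
    have := prod_unitPart_reflect hn (x := (0 : ℤ_[p])) (dvd_zero _)
    simpa using this
  have hYu : IsUnit Y := IsUnit.prod_iff.2 fun j _ => isUnit_unitPart _
  have hXY : (p : ℤ_[p]) ∣ X - Y := by
    rw [hX, hY]
    generalize Finset.range n = t
    classical
    induction t using Finset.induction_on with
    | empty => simp
    | insert a t ha ih =>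
      rw [Finset.prod_insert ha, Finset.prod_insert ha]
      refine pow_dvd_mul_sub_mul ?_ ih
      have := pow_dvd_unitPart_sub (p := p) one_ne_zero (x := (n : ℤ_[p]) + a) (y := a)
        (by simpa using hn')
      simpa using this
  choose z hz1 hz2 using unitPart_mul_shift (n : ℤ_[p]) hn'
  obtain ⟨r, hr⟩ := prod_one_add_mul_eq (Finset.range n) (2 * (n : ℤ_[p]) ^ 2) z
  have hsq : X * X = Y * Y * (1 + 2 * (n : ℤ_[p]) ^ 2 * ∑ j ∈ Finset.range n, z j +
      (2 * (n : ℤ_[p]) ^ 2) ^ 2 * r) := by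
    nth_rewrite 2 [hX2]
    nth_rewrite 2 [hY2]
    rw [hX, hY, ← hr, ← Finset.prod_mul_distrib, ← Finset.prod_mul_distrib,
      ← Finset.prod_mul_distrib]
    exact Finset.prod_congr rfl fun j _ => hz1 j
  have hd : (p : ℤ_[p]) ^ N ∣ X * X - Y * Y := by
    obtain ⟨w, hw⟩ := hn'
    rcases hN with rfl | ⟨rfl, h5⟩
    · refine ⟨Y * Y * (2 * w ^ 2 * ∑ j ∈ Finset.range n, z j +
        4 * p ^ 2 * w ^ 4 * r), ?_⟩
      rw [hsq, hw]; ring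
    · have hsum : (p : ℤ_[p]) ∣ ∑ j ∈ Finset.range n, z j := by
        rw [← Ideal.mem_span_singleton, ← PadicInt.maximalIdeal_eq_span_p, ← PadicInt.ker_toZMod,
          RingHom.mem_ker, map_sum]
        simp only [hz2]
        obtain ⟨m, rfl⟩ := hn
        rw [ZMod.sum_range_mul_natCast (fun x : ZMod p => -(x⁻¹ ^ 2)), Finset.sum_neg_distrib,
          ZMod.sum_inv_sq h5]
        simp
      obtain ⟨v, hv⟩ := hsum
      refine ⟨Y * Y * (2 * w ^ 2 * v + 4 * p * w ^ 4 * r), ?_⟩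
      rw [hsq, hv, hw]; ring
  have hfin := PadicInt.pow_dvd_sub_of_sq hp hYu hXY hd
  have e1 := padicGamma_add_nat hp (n : ℤ_[p]) n
  rw [← hX] at e1
  have e2 := padicGamma_nat hp n
  rw [← hY] at e2
  have : padicGamma p ((n : ℤ_[p]) + n) - padicGamma p (n : ℤ_[p]) ^ 2 =
      (-1) ^ n * padicGamma p (n : ℤ_[p]) * (X - Y) := by
    rw [e1, sq]
    nth_rewrite 3 [e2]
    ring
  rw [this]
  exact hfin.mul_left _

theorem pow_dvd_padicGamma_add_self_sub_sq (hp : p ≠ 2) {s : ℤ_[p]} (hs : (p : ℤ_[p]) ∣ s) {N : ℕ}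
    (hN : N = 2 ∨ (N = 3 ∧ 5 ≤ p)) :
    (p : ℤ_[p]) ^ N ∣ padicGamma p (s + s) - padicGamma p s ^ 2 := by
  have hN0 : N ≠ 0 := by omega
  obtain ⟨n, hn⟩ := PadicInt.exists_nat_pow_dvd_sub s N
  have h1 := pow_dvd_padicGamma_nat_add_self_sub_sq hp
    (PadicInt.dvd_of_dvd_sub_natCast hN0 hs hn) hN
  have h2 := pow_dvd_padicGamma_sub hp hN0 hn
  have h3 := pow_dvd_padicGamma_sub hp hN0 (x := s + s) (y := (n : ℤ_[p]) + n) (by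
    rw [add_sub_add_comm]; exact dvd_add hn hn)
  have h4 := pow_dvd_mul_sub_mul h2 h2
  have := dvd_sub (dvd_add h1 h3) h4
  convert this using 1
  ring

/-- The cube-and-duplication congruence `Γ_p(-2s) ≡ Γ_p(s) Γ_p(-s)³` for `s ∈ p ℤ_p`. -/
theorem pow_dvd_padicGamma_neg_two_mul_sub (hp : p ≠ 2) {s : ℤ_[p]} (hs : (p : ℤ_[p]) ∣ s) {N : ℕ}
    (hN : N = 2 ∨ (N = 3 ∧ 5 ≤ p)) :
    (p : ℤ_[p]) ^ N ∣ padicGamma p (-(2 * s)) - padicGamma p s * padicGamma p (-s) ^ 3 := by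
  have h := pow_dvd_padicGamma_add_self_sub_sq hp (s := -s) (by simpa using hs) hN
  have h1 := padicGamma_mul_neg hp hs
  rw [show -(2 * s) = -s + -s by ring]
  convert h using 1
  linear_combination (-padicGamma p (-s) ^ 2) * h1

end GammaMultiples

/-! ### Binomial and harmonic sums antisymmetric under `k ↦ a - k`. -/

theorem ascPochhammer_eval_neg_natCast {R : Type*} [CommRing R] (a k : ℕ) :
    (ascPochhammer R k).eval (-(a : R)) = (-1) ^ k * (k.factorial * a.choose k) := by
  rw [ascPochhammer_eval_neg_eq_descPochhammer, descPochhammer_eval_eq_descFactorial,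
    Nat.descFactorial_eq_factorial_mul_choose, Nat.cast_mul]

theorem sum_range_eq_zero_of_antisymm {F : Type*} [Field F] (h2 : (2 : F) ≠ 0) (a : ℕ) (f : ℕ → F)
    (hf : ∀ k ≤ a, f (a - k) = -f k) : ∑ k ∈ Finset.range (a + 1), f k = 0 := by
  have h := Finset.sum_range_reflect f (a + 1)
  have h' : ∑ k ∈ Finset.range (a + 1), f (a + 1 - 1 - k) = -∑ k ∈ Finset.range (a + 1), f k := by
    rw [← Finset.sum_neg_distrib]
    refine Finset.sum_congr rfl fun k hk => ?_
    rw [Nat.add_sub_cancel, hf k (Nat.lt_succ_iff.1 (Finset.mem_range.1 hk))]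
  have h3 : 2 * ∑ k ∈ Finset.range (a + 1), f k = 0 := by linear_combination h' - h
  exact (mul_eq_zero.1 h3).resolve_left h2

/-- The difference of harmonic numbers `H_k + H_{a-k} - H_a`, written without truncated
subtraction. -/
def harmonicDefect {F : Type*} [Field F] (a k : ℕ) : F :=
  ∑ i ∈ Finset.range k, (-(a : F) + i)⁻¹ + ∑ i ∈ Finset.range k, (1 + (i : F))⁻¹

theorem harmonicDefect_eq {F : Type*} [Field F] {a k : ℕ} (hk : k ≤ a) :
    (harmonicDefect a k : F) = ∑ i ∈ Finset.range k, (1 + (i : F))⁻¹ +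
      ∑ i ∈ Finset.range (a - k), (1 + (i : F))⁻¹ - ∑ i ∈ Finset.range a, (1 + (i : F))⁻¹ := by
  have h1 : ∑ i ∈ Finset.range a, (1 + (i : F))⁻¹ = ∑ i ∈ Finset.range (a - k), (1 + (i : F))⁻¹ +
      ∑ i ∈ Finset.range k, (1 + ((a - k + i : ℕ) : F))⁻¹ := by
    rw [← Finset.sum_range_add (fun i : ℕ => (1 + (i : F))⁻¹), Nat.sub_add_cancel hk]
  have h2 : ∑ i ∈ Finset.range k, (-(a : F) + i)⁻¹ =
      -∑ i ∈ Finset.range k, (1 + ((a - k + i : ℕ) : F))⁻¹ := by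
    rw [← Finset.sum_neg_distrib, ← Finset.sum_range_reflect]
    refine Finset.sum_congr rfl fun i hi => ?_
    have hi' := Finset.mem_range.1 hi
    rw [← inv_neg]
    congr 1
    push_cast [Nat.cast_sub hk]
    rw [Nat.sub_sub, Nat.cast_sub (by omega)]
    push_cast
    ring
  rw [harmonicDefect, h1, h2]
  ring

/-- The four signs cancel, `a.choose k` and the harmonic defect are symmetric under `k ↦ a - k`, and
the weight `-a + 2k` changes sign. -/
theorem sum_choose_mul_harmonicDefect {F : Type*} [Field F] (h2 : (2 : F) ≠ 0) (a : ℕ) :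
    ∑ k ∈ Finset.range (a + 1), (-(a : F) + 2 * k) * ((-1) ^ k * (a.choose k : F)) *
      ((-1) ^ k * (a.choose k : F) * harmonicDefect a k) ^ 3 = 0 := by
  refine sum_range_eq_zero_of_antisymm h2 a _ fun k hk => ?_
  have hs : ∀ j : ℕ, ((-1 : F) ^ j) ^ 4 = 1 := fun j => by
    rw [← pow_mul, mul_comm, pow_mul]; norm_num
  rw [Nat.choose_symm hk, harmonicDefect_eq (Nat.sub_le a k), harmonicDefect_eq hk,
    Nat.sub_sub_self hk, Nat.cast_sub hk]
  linear_combination ((-(a : F) + 2 * (a - k)) * (a.choose k : F) ^ 4 *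
    (∑ i ∈ Finset.range (a - k), (1 + (i : F))⁻¹ + ∑ i ∈ Finset.range k, (1 + (i : F))⁻¹ -
      ∑ i ∈ Finset.range a, (1 + (i : F))⁻¹) ^ 3) * (hs (a - k) - hs k)

theorem sum_choose_pow_four {F : Type*} [Field F] (h2 : (2 : F) ≠ 0) (a : ℕ) :
    ∑ k ∈ Finset.range (a + 1), (-(a : F) + 2 * k) * (a.choose k : F) ^ 4 = 0 := by
  refine sum_range_eq_zero_of_antisymm h2 a _ fun k hk => ?_
  rw [Nat.choose_symm hk, Nat.cast_sub hk]
  ring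

/-! ### The cubic error term modulo `p^4`. -/

section ErrorTerm

variable {p : ℕ} [Fact p.Prime]

theorem PadicInt.toZMod_inverse {x : ℤ_[p]} (hx : IsUnit x) :
    PadicInt.toZMod (Ring.inverse x) = (PadicInt.toZMod x)⁻¹ := by
  refine eq_inv_of_mul_eq_one_right ?_
  rw [← map_mul, Ring.mul_inverse_cancel x hx, map_one]

theorem PadicInt.prime_dvd_iff_toZMod (x : ℤ_[p]) :
    (p : ℤ_[p]) ∣ x ↔ PadicInt.toZMod x = 0 := by
  rw [← RingHom.mem_ker, PadicInt.ker_toZMod, PadicInt.maximalIdeal_eq_span_p,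
    Ideal.mem_span_singleton]

theorem PadicInt.isUnit_iff_toZMod_ne_zero (x : ℤ_[p]) :
    IsUnit x ↔ PadicInt.toZMod x ≠ 0 := by
  rw [PadicInt.isUnit_iff_not_prime_dvd, PadicInt.prime_dvd_iff_toZMod]

theorem ZMod.natCast_ne_zero_of_lt {i : ℕ} (h0 : i ≠ 0) (hi : i < p) : (i : ZMod p) ≠ 0 := by
  rw [Ne, ZMod.natCast_eq_zero_iff]
  exact Nat.not_dvd_of_pos_of_lt (Nat.pos_of_ne_zero h0) hi

theorem isUnit_one_add_add {s : ℤ_[p]} (hs : (p : ℤ_[p]) ∣ s) {i : ℕ} (hi : i + 1 < p) :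
    IsUnit (1 + s + (i : ℤ_[p])) := by
  rw [PadicInt.isUnit_iff_toZMod_ne_zero]
  rw [PadicInt.prime_dvd_iff_toZMod] at hs
  have := ZMod.natCast_ne_zero_of_lt (p := p) (Nat.succ_ne_zero i) hi
  push_cast at this
  simpa [hs, add_comm] using this

theorem isUnit_ascPochhammer_one_add {s : ℤ_[p]} (hs : (p : ℤ_[p]) ∣ s) {k : ℕ} (hk : k < p) :
    IsUnit ((ascPochhammer ℤ_[p] k).eval (1 + s)) := by
  rw [ascPochhammer_eval_eq_prod]
  refine IsUnit.prod_iff.2 fun i hi => isUnit_one_add_add hs ?_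
  have := Finset.mem_range.1 hi
  omega

theorem isUnit_factorial {k : ℕ} (hk : k < p) : IsUnit (k.factorial : ℤ_[p]) := by
  have := isUnit_ascPochhammer_one_add (p := p) (s := 0) (dvd_zero _) hk
  simpa using this

theorem exists_prod_add_eq {k : ℕ} (c : ℕ → ℤ_[p]) (hc : ∀ i < k, IsUnit (c i)) (s : ℤ_[p]) :
    ∃ r, ∏ i ∈ Finset.range k, (c i + s) = (∏ i ∈ Finset.range k, c i) *
      (1 + s * ∑ i ∈ Finset.range k, Ring.inverse (c i) + s ^ 2 * r) := by
  obtain ⟨r, hr⟩ := prod_one_add_mul_eq (Finset.range k) s (fun i => Ring.inverse (c i))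
  refine ⟨r, ?_⟩
  rw [← hr, ← Finset.prod_mul_distrib]
  refine Finset.prod_congr rfl fun i hi => ?_
  have := Ring.mul_inverse_cancel _ (hc i (Finset.mem_range.1 hi))
  linear_combination (-s) * this

/-- The ratio `(s - a)_k / k!`. -/
noncomputable def pochRatio (a : ℕ) (s : ℤ_[p]) (k : ℕ) : ℤ_[p] :=
  (ascPochhammer ℤ_[p] k).eval (-(a : ℤ_[p]) + s) * Ring.inverse (k.factorial : ℤ_[p])

/-- The ratio `(-a)_k / (1 + s)_k`. -/
noncomputable def shiftedPochRatio (a : ℕ) (s : ℤ_[p]) (k : ℕ) : ℤ_[p] :=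
  (ascPochhammer ℤ_[p] k).eval (-(a : ℤ_[p])) *
    Ring.inverse ((ascPochhammer ℤ_[p] k).eval (1 + s))

theorem ascPochhammer_neg_natCast_eq_zero {R : Type*} [CommRing R] {a k : ℕ} (h : a < k) :
    (ascPochhammer R k).eval (-(a : R)) = 0 := by
  rw [ascPochhammer_eval_neg_natCast, Nat.choose_eq_zero_of_lt h]
  simp

theorem dvd_ascPochhammer_eval {R : Type*} [CommRing R] {a k : ℕ} (h : a < k) (s : R) :
    s ∣ (ascPochhammer R k).eval (-(a : R) + s) := by
  rw [ascPochhammer_eval_eq_prod]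
  have := Finset.dvd_prod_of_mem (fun i : ℕ => -(a : R) + s + i) (Finset.mem_range.2 h)
  simpa using this

theorem toZMod_pochRatio {s : ℤ_[p]} (hs : (p : ℤ_[p]) ∣ s) (a : ℕ) {k : ℕ} (hk : k < p) :
    PadicInt.toZMod (pochRatio a s k) = (-1) ^ k * (a.choose k : ZMod p) := by
  have hf := isUnit_factorial (p := p) hk
  have hf0 := (PadicInt.isUnit_iff_toZMod_ne_zero _).1 hf
  rw [PadicInt.prime_dvd_iff_toZMod] at hs
  have h1 : PadicInt.toZMod ((ascPochhammer ℤ_[p] k).eval (-(a : ℤ_[p]) + s)) =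
      (ascPochhammer (ZMod p) k).eval (-(a : ZMod p)) := by
    rw [ascPochhammer_eval_eq_prod, ascPochhammer_eval_eq_prod, map_prod]
    simp [hs]
  rw [pochRatio, map_mul, PadicInt.toZMod_inverse hf, h1, ascPochhammer_eval_neg_natCast]
  rw [map_natCast] at hf0 ⊢
  field_simp

/-- For `k ≤ a` the quotient of the two ratios is `(s-a)_k (1+s)_k / ((-a)_k k!)`, whose logarithmic
derivative at `s = 0` is the harmonic defect. For `k > a` the shifted ratio is `0` and the other
contains the factor `s`. -/
theorem exists_pochRatio_sub_eq {s : ℤ_[p]} (hs : (p : ℤ_[p]) ∣ s) {a k : ℕ} (ha : a < p)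
    (hk : k < p) :
    ∃ v, pochRatio a s k - shiftedPochRatio a s k = s * v ∧
      (k ≤ a → PadicInt.toZMod v = (-1) ^ k * (a.choose k : ZMod p) * harmonicDefect a k) := by
  rcases lt_or_ge a k with h | h
  · obtain ⟨v, hv⟩ := dvd_ascPochhammer_eval h s
    refine ⟨v * Ring.inverse (k.factorial : ℤ_[p]), ?_, fun h' => absurd h' (by omega)⟩
    rw [pochRatio, shiftedPochRatio, ascPochhammer_neg_natCast_eq_zero h, hv]
    ring
  have hs0 := (PadicInt.prime_dvd_iff_toZMod s).1 hs
  have hf := isUnit_factorial (p := p) hk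
  have hD := isUnit_ascPochhammer_one_add hs hk
  have hc1 : ∀ i < k, IsUnit (-(a : ℤ_[p]) + i) := fun i hi => by
    rw [PadicInt.isUnit_iff_toZMod_ne_zero]
    have := ZMod.natCast_ne_zero_of_lt (p := p) (i := a - i) (by omega) (by omega)
    rw [Nat.cast_sub (by omega)] at this
    rw [map_add, map_neg, map_natCast, map_natCast]
    intro h0
    exact this (by linear_combination -h0)
  have hc2 : ∀ i < k, IsUnit (1 + (i : ℤ_[p])) := fun i hi => by
    have := isUnit_one_add_add (p := p) (s := 0) (dvd_zero _) (i := i) (by omega)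
    simpa using this
  obtain ⟨r, hr⟩ := exists_prod_add_eq _ hc1 s
  obtain ⟨r', hr'⟩ := exists_prod_add_eq _ hc2 s
  have hX : (ascPochhammer ℤ_[p] k).eval (-(a : ℤ_[p]) + s) =
      (ascPochhammer ℤ_[p] k).eval (-(a : ℤ_[p])) *
        (1 + s * ∑ i ∈ Finset.range k, Ring.inverse (-(a : ℤ_[p]) + i) + s ^ 2 * r) := by
    rw [ascPochhammer_eval_eq_prod, ascPochhammer_eval_eq_prod, ← hr]
    exact Finset.prod_congr rfl fun i _ => by ring
  have hD' : (ascPochhammer ℤ_[p] k).eval (1 + s) = (k.factorial : ℤ_[p]) *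
        (1 + s * ∑ i ∈ Finset.range k, Ring.inverse (1 + (i : ℤ_[p])) + s ^ 2 * r') := by
    have : (k.factorial : ℤ_[p]) = ∏ i ∈ Finset.range k, (1 + (i : ℤ_[p])) := by
      rw [← ascPochhammer_eval_eq_prod]; simp
    rw [ascPochhammer_eval_eq_prod, this, ← hr']
    exact Finset.prod_congr rfl fun i _ => by ring
  have hN := ascPochhammer_eval_neg_natCast (R := ℤ_[p]) a k
  have i1 := Ring.mul_inverse_cancel _ hf
  have i2 := Ring.mul_inverse_cancel _ hD
  have hf0 := (PadicInt.isUnit_iff_toZMod_ne_zero _).1 hf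
  have hDz : PadicInt.toZMod ((ascPochhammer ℤ_[p] k).eval (1 + s)) = (k.factorial : ZMod p) := by
    rw [hD']
    simp [hs0]
  have hhz : PadicInt.toZMod (∑ i ∈ Finset.range k, Ring.inverse (-(a : ℤ_[p]) + i) +
      ∑ i ∈ Finset.range k, Ring.inverse (1 + (i : ℤ_[p]))) = harmonicDefect a k := by
    rw [harmonicDefect, map_add, map_sum, map_sum]
    congr 1
    · refine Finset.sum_congr rfl fun i hi => ?_
      rw [PadicInt.toZMod_inverse (hc1 i (Finset.mem_range.1 hi))]
      simp
    · refine Finset.sum_congr rfl fun i hi => ?_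
      rw [PadicInt.toZMod_inverse (hc2 i (Finset.mem_range.1 hi))]
      simp
  rw [pochRatio, shiftedPochRatio]
  have hNz := congrArg PadicInt.toZMod hN
  generalize (ascPochhammer ℤ_[p] k).eval (-(a : ℤ_[p]) + s) = X at *
  generalize (ascPochhammer ℤ_[p] k).eval (-(a : ℤ_[p])) = N at *
  generalize ∑ i ∈ Finset.range k, Ring.inverse (-(a : ℤ_[p]) + i) = h1 at *
  generalize ∑ i ∈ Finset.range k, Ring.inverse (1 + (i : ℤ_[p])) = h2 at *
  have i3 := PadicInt.toZMod_inverse hD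
  generalize (ascPochhammer ℤ_[p] k).eval (1 + s) = D at *
  generalize Ring.inverse D = D' at *
  generalize hF : (k.factorial : ℤ_[p]) = f at *
  generalize Ring.inverse f = f' at *
  refine ⟨N * D' * (h1 + h2 + s * (r + r' + h1 * h2) + s ^ 2 * (h1 * r' + h2 * r) +
    s ^ 3 * (r * r')), ?_, fun _ => ?_⟩
  · linear_combination (-X * f') * i2 + N * D' * i1 + f' * D' * D * hX +
      f' * D' * N * (1 + s * h1 + s ^ 2 * r) * hD' + D' * N * (s * (h1 + h2) + s ^ 2 * (r + r' + h1 * h2) +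
        s ^ 3 * (h1 * r' + h2 * r) + s ^ 4 * (r * r')) * i1
  · have : PadicInt.toZMod f = (k.factorial : ZMod p) := by rw [← hF, map_natCast]
    rw [map_add] at hhz
    simp only [map_mul, map_add, map_pow, hs0, i3, hDz, hNz, map_neg, map_one, map_natCast, this,
      hhz] at hf0 ⊢
    field_simp
    ring

theorem pow_four_dvd_sum_pochRatio {s : ℤ_[p]} (hp : p ≠ 2) (hs : (p : ℤ_[p]) ∣ s) {a : ℕ}
    (ha : a < p) :
    (p : ℤ_[p]) ^ 4 ∣ ∑ k ∈ Finset.range p, (-(a : ℤ_[p]) + s + 2 * k) * pochRatio a s k *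
      (pochRatio a s k - shiftedPochRatio a s k) ^ 3 := by
  have hs0 := (PadicInt.prime_dvd_iff_toZMod s).1 hs
  have h2' : PadicInt.toZMod (2 : ℤ_[p]) = 2 := map_ofNat _ 2
  have h2 : (2 : ZMod p) ≠ 0 := by
    rw [← h2', Ne, ← PadicInt.prime_dvd_iff_toZMod]
    exact PadicInt.not_prime_dvd_two hp
  have hv : ∀ k : ℕ, ∃ v, k < p → (pochRatio a s k - shiftedPochRatio a s k = s * v ∧
      (k ≤ a → PadicInt.toZMod v = (-1) ^ k * (a.choose k : ZMod p) * harmonicDefect a k)) :=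
    fun k => by
      by_cases hk : k < p
      · obtain ⟨v, hv⟩ := exists_pochRatio_sub_eq hs ha hk
        exact ⟨v, fun _ => hv⟩
      · exact ⟨0, fun h => absurd h hk⟩
  choose v hv using hv
  have e : ∑ k ∈ Finset.range p, (-(a : ℤ_[p]) + s + 2 * k) * pochRatio a s k *
      (pochRatio a s k - shiftedPochRatio a s k) ^ 3 =
      s ^ 3 * ∑ k ∈ Finset.range p, (-(a : ℤ_[p]) + s + 2 * k) * pochRatio a s k * v k ^ 3 := by
    rw [Finset.mul_sum]
    refine Finset.sum_congr rfl fun k hk => ?_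
    rw [(hv k (Finset.mem_range.1 hk)).1]
    ring
  rw [e, pow_succ]
  refine mul_dvd_mul (pow_dvd_pow_of_dvd hs 3) ?_
  rw [PadicInt.prime_dvd_iff_toZMod, map_sum, ← sum_choose_mul_harmonicDefect h2 a]
  symm
  -- For `k > a` the unshifted ratio is itself `0` modulo `p`, so the unknown residue of `v k` is
  -- harmless there.
  refine Finset.sum_subset_zero_on_sdiff (Finset.range_subset_range.2 ha) ?_ ?_
  · intro k hk
    rw [Finset.mem_sdiff, Finset.mem_range, Finset.mem_range] at hk
    rw [map_mul, map_mul, toZMod_pochRatio hs a hk.1, Nat.choose_eq_zero_of_lt (by omega)]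
    simp
  · intro k hk
    rw [Finset.mem_range] at hk
    have hkp : k < p := by omega
    rw [map_mul, map_mul, toZMod_pochRatio hs a hkp, map_pow, (hv k hkp).2 (by omega)]
    simp [hs0, h2']

end ErrorTerm

/-! ### Interpolation modulo `s^3`. -/

theorem Polynomial.exists_eval_eq_quadratic {R : Type*} [CommRing R] (P : Polynomial R) :
    ∃ e₀ e₁ e₂ : R, ∀ x, ∃ r, P.eval x = e₀ + e₁ * x + e₂ * x ^ 2 + x ^ 3 * r := by
  have h : ∀ (Q : Polynomial R) (x : R), Q.eval x = Q.divX.eval x * x + Q.coeff 0 := fun Q x => by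
    conv_lhs => rw [← Polynomial.divX_mul_X_add Q]
    simp
  refine ⟨P.coeff 0, P.divX.coeff 0, P.divX.divX.coeff 0, fun x => ⟨P.divX.divX.divX.eval x, ?_⟩⟩
  rw [h P, h P.divX, h P.divX.divX]
  ring

/-- Heuristically, normalize `E 0 = 1` and put `t = 1 / E s`, so `t ≡ 1` modulo `s`. The sequence
`Q(js) t^(j+1)`, `j = -2, …, 1`, is quadratic in `j` modulo `s^3`, so its third difference vanishes.
Likewise `E(-2s) / E(-s)^3 = E(s)`, which identifies the term `j = -2`. With denominators cleared
the identity needs no invertibility. -/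
theorem quadratic_interpolation {R : Type*} [CommRing R] (e₀ e₁ e₂ q₀ q₁ q₂ s : R)
    (hs : s ^ 3 = 0) (E Q : R → R) (hE : ∀ n : ℤ, E (n * s) = e₀ + e₁ * (n * s) + e₂ * (n * s) ^ 2)
    (hQ : ∀ n : ℤ, Q (n * s) = q₀ + q₁ * (n * s) + q₂ * (n * s) ^ 2) :
    3 * Q (-s) * E s ^ 2 * E (-s) ^ 3 - 3 * Q 0 * E 0 * E s * E (-s) ^ 3 +
      Q s * E 0 ^ 2 * E (-s) ^ 3 = E (-(2 * s)) * Q (-(2 * s)) * E 0 ^ 2 * E s ^ 2 := by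
  have a1 := hE 1
  have a2 := hE (-1)
  have a3 := hE 0
  have a4 := hE (-2)
  have b1 := hQ 1
  have b2 := hQ (-1)
  have b3 := hQ 0
  have b4 := hQ (-2)
  push_cast at a1 a2 a3 a4 b1 b2 b3 b4
  simp only [one_mul, zero_mul, neg_mul] at a1 a2 a3 a4 b1 b2 b3 b4
  rw [a1, a2, a3, a4, b1, b2, b3, b4]
  clear a1 a2 a3 a4 b1 b2 b3 b4 hE hQ
  grind

theorem Polynomial.cube_dvd_interpolation {R : Type*} [CommRing R] (E Q : Polynomial R) (s : R) :
    s ^ 3 ∣ 3 * Q.eval (-s) * E.eval s ^ 2 * E.eval (-s) ^ 3 -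
      3 * Q.eval 0 * E.eval 0 * E.eval s * E.eval (-s) ^ 3 +
      Q.eval s * E.eval 0 ^ 2 * E.eval (-s) ^ 3 -
      E.eval (-(2 * s)) * Q.eval (-(2 * s)) * E.eval 0 ^ 2 * E.eval s ^ 2 := by
  let φ := Ideal.Quotient.mk (Ideal.span {s ^ 3})
  have hs : φ s ^ 3 = 0 := by
    rw [← map_pow, Ideal.Quotient.eq_zero_iff_mem]
    exact Ideal.mem_span_singleton_self _
  have hquad : ∀ P : Polynomial (R ⧸ Ideal.span {s ^ 3}), ∃ e₀ e₁ e₂, ∀ n : ℤ,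
      P.eval (n * φ s) = e₀ + e₁ * (n * φ s) + e₂ * (n * φ s) ^ 2 := fun P => by
    obtain ⟨e₀, e₁, e₂, h⟩ := P.exists_eval_eq_quadratic
    refine ⟨e₀, e₁, e₂, fun n => ?_⟩
    obtain ⟨r, hr⟩ := h (n * φ s)
    rw [hr, mul_pow _ _ 3, hs]
    ring
  obtain ⟨e₀, e₁, e₂, hE⟩ := hquad (E.map φ)
  obtain ⟨q₀, q₁, q₂, hQ⟩ := hquad (Q.map φ)
  have key := quadratic_interpolation e₀ e₁ e₂ q₀ q₁ q₂ (φ s) hs (fun x => (E.map φ).eval x)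
    (fun x => (Q.map φ).eval x) hE hQ
  have hev : ∀ (P : Polynomial R) (x : R), φ (P.eval x) = (P.map φ).eval (φ x) := fun P x => by
    rw [Polynomial.eval_map, Polynomial.eval₂_hom]
  rw [← Ideal.mem_span_singleton, ← Ideal.Quotient.eq_zero_iff_mem]
  change φ _ = 0
  rw [← map_zero φ] at key
  simp only [← map_neg, ← hev] at key
  rw [show (2 : R ⧸ Ideal.span {s ^ 3}) = φ 2 from (map_ofNat φ 2).symm, ← map_mul φ 2,
    ← map_neg, ← hev, ← hev, show (3 : R ⧸ Ideal.span {s ^ 3}) = φ 3 from (map_ofNat φ 3).symm]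
    at key
  simp only [map_sub, map_add, map_mul, map_pow] at key ⊢
  rw [key, sub_self]

/-! ### Closed forms of the three sums and their combination modulo `p^4`. -/

section Sums

variable {p : ℕ} [Fact p.Prime]

theorem PadicInt.coe_ascPochhammer_eval (k : ℕ) (x : ℤ_[p]) :
    (((ascPochhammer ℤ_[p] k).eval x : ℤ_[p]) : ℚ_[p]) =
      (ascPochhammer ℚ_[p] k).eval (x : ℚ_[p]) := by
  rw [ascPochhammer_eval_eq_prod, ascPochhammer_eval_eq_prod]
  refine (map_prod (PadicInt.Coe.ringHom (p := p)) _ _).trans (Finset.prod_congr rfl fun i _ => ?_)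
  rfl

theorem PadicInt.coe_inverse {x : ℤ_[p]} (hx : IsUnit x) :
    ((Ring.inverse x : ℤ_[p]) : ℚ_[p]) = (x : ℚ_[p])⁻¹ := by
  refine eq_inv_of_mul_eq_one_right ?_
  rw [← PadicInt.coe_mul, Ring.mul_inverse_cancel x hx, PadicInt.coe_one]

theorem PadicInt.coe_ne_zero_of_isUnit {x : ℤ_[p]} (hx : IsUnit x) : (x : ℚ_[p]) ≠ 0 := by
  rw [Ne, PadicInt.coe_eq_zero]
  exact hx.ne_zero

theorem PadicInt.coe_two : ((2 : ℤ_[p]) : ℚ_[p]) = 2 := rfl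

/-- Very well-poised summation over `k < p` with leading parameter `s - a`, where `p ∣ s`. -/
theorem sum_range_wellPoisedTerm {a : ℕ} (ha : a < p) {s y z : ℤ_[p]}
    (hs : (p : ℤ_[p]) ∣ s) (hy : s ∣ y) (hz : s ∣ z) :
    (∑ k ∈ Finset.range p, wellPoisedTerm (-(a : ℚ_[p]) + s) (-(a : ℚ_[p]) + s - y)
      (-(a : ℚ_[p]) + s - z) a k) *
      ((ascPochhammer ℚ_[p] a).eval (1 + (y : ℚ_[p])) *
        (ascPochhammer ℚ_[p] a).eval (1 + (z : ℚ_[p]))) =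
    (-(a : ℚ_[p]) + s) * (ascPochhammer ℚ_[p] a).eval (1 + (-(a : ℚ_[p]) + s)) *
      (ascPochhammer ℚ_[p] a).eval (1 + (a : ℚ_[p]) - s + y + z) := by
  have hsub : ∑ k ∈ Finset.range p, wellPoisedTerm (-(a : ℚ_[p]) + s) (-(a : ℚ_[p]) + s - y)
      (-(a : ℚ_[p]) + s - z) a k = ∑ k ∈ Finset.range (a + 1), wellPoisedTerm (-(a : ℚ_[p]) + s)
      (-(a : ℚ_[p]) + s - y) (-(a : ℚ_[p]) + s - z) a k := by
    symm
    refine Finset.sum_subset (Finset.range_subset_range.2 ha) fun k _ hk => ?_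
    rw [Finset.mem_range, not_lt] at hk
    rw [wellPoisedTerm, ascPochhammer_neg_natCast_eq_zero (by omega)]
    simp
  rw [hsub]
  -- For `s = 0` the lower parameter `1 + A + a` is still harmless, but `(1 + A)_{2a}` vanishes when
  -- `a > 0` and the summation formula does not apply; both sides are then `0` by antisymmetry.
  by_cases hs0 : s = 0
  · subst hs0
    rw [zero_dvd_iff] at hy hz
    subst hy hz
    rcases Nat.eq_zero_or_pos a with rfl | ha0
    · simp [wellPoisedTerm]
    have h0 : (ascPochhammer ℚ_[p] a).eval (1 + (-(a : ℚ_[p]) + (0 : ℤ_[p]))) = 0 := by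
      rw [ascPochhammer_eval_eq_prod]
      refine Finset.prod_eq_zero (Finset.mem_range.2 (Nat.sub_lt ha0 one_pos)) ?_
      rw [Nat.cast_pred ha0, PadicInt.coe_zero]
      ring
    rw [h0, mul_zero, zero_mul]
    convert zero_mul _
    rw [← sum_choose_pow_four (F := ℚ_[p]) two_ne_zero a]
    refine Finset.sum_congr rfl fun k _ => ?_
    have hf : (k.factorial : ℚ_[p]) ≠ 0 := by exact_mod_cast k.factorial_ne_zero
    have hsg : ((-1 : ℚ_[p]) ^ k) ^ 4 = 1 := by
      rw [← pow_mul, mul_comm, pow_mul]; norm_num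
    simp only [wellPoisedTerm, PadicInt.coe_zero, add_zero, sub_zero, add_sub_cancel_right,
      neg_add_cancel_right, ascPochhammer_eval_neg_natCast, ascPochhammer_eval_one]
    field_simp
    rw [hsg]
    ring
  -- A zero factor would make `s` an integer of absolute value at most `a < p`; being divisible by
  -- `p`, it would be `0`.
  have hA : ∀ i < 2 * a, 1 + (-(a : ℚ_[p]) + s) + i ≠ 0 := fun i hi h => by
    have h1 : s = ((a - 1 - i : ℤ) : ℤ_[p]) := by
      apply PadicInt.ext
      push_cast
      linear_combination h
    have h2 : (p : ℤ) ∣ (a - 1 - i : ℤ) := by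
      have := (PadicInt.pow_dvd_intCast (p := p) 1 (a - 1 - i : ℤ)).1
        (by rw [pow_one, ← h1]; exact hs)
      simpa using this
    have h3 : (a - 1 - i : ℤ) = 0 :=
      Int.eq_zero_of_abs_lt_dvd h2 (by rw [abs_lt]; omega)
    rw [h3] at h1
    exact hs0 (by simpa using h1)
  have hB : ∀ x : ℤ_[p], s ∣ x → ∀ i < a,
      1 + (-(a : ℚ_[p]) + s) - (-(a : ℚ_[p]) + s - x) + i ≠ 0 := fun x hx i hi => by
    have := PadicInt.coe_ne_zero_of_isUnit
      (isUnit_one_add_add (hs.trans hx) (i := i) (by omega))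
    push_cast at this
    convert this using 2
    ring
  have key := sum_wellPoisedTerm (-(a : ℚ_[p]) + s) (-(a : ℚ_[p]) + s - y) (-(a : ℚ_[p]) + s - z) a
    hA (hB y hy) (hB z hz)
  convert key using 4 <;> ring

theorem coe_pochRatio {a k : ℕ} (hk : k < p) (s : ℤ_[p]) :
    ((pochRatio a s k : ℤ_[p]) : ℚ_[p]) =
      (ascPochhammer ℚ_[p] k).eval (-(a : ℚ_[p]) + s) / (k.factorial : ℚ_[p]) := by
  rw [pochRatio, PadicInt.coe_mul, PadicInt.coe_inverse (isUnit_factorial hk),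
    PadicInt.coe_ascPochhammer_eval]
  push_cast
  rw [div_eq_mul_inv]

theorem coe_shiftedPochRatio {a k : ℕ} (hk : k < p) {s : ℤ_[p]} (hs : (p : ℤ_[p]) ∣ s) :
    ((shiftedPochRatio a s k : ℤ_[p]) : ℚ_[p]) =
      (ascPochhammer ℚ_[p] k).eval (-(a : ℚ_[p])) / (ascPochhammer ℚ_[p] k).eval (1 + (s : ℚ_[p])) := by
  rw [shiftedPochRatio, PadicInt.coe_mul, PadicInt.coe_inverse (isUnit_ascPochhammer_one_add hs hk),
    PadicInt.coe_ascPochhammer_eval, PadicInt.coe_ascPochhammer_eval]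
  push_cast
  rw [div_eq_mul_inv]

/-- The sums obtained by replacing one, two or three of the ratios `(s - a)_k / k!` by
`(-a)_k / (1 + s)_k`. -/
theorem sum_pochRatio_eq {a : ℕ} (ha : a < p) {s : ℤ_[p]} (hs : (p : ℤ_[p]) ∣ s) :
    (∑ k ∈ Finset.range p, (-(a : ℤ_[p]) + s + 2 * k) * pochRatio a s k ^ 3 *
        shiftedPochRatio a s k) * (ascPochhammer ℤ_[p] a).eval (1 + 0) ^ 2 =
      (-(a : ℤ_[p]) + s) * (ascPochhammer ℤ_[p] a).eval (1 + (-(a : ℤ_[p]) + s)) *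
        (ascPochhammer ℤ_[p] a).eval (1 + a + -s) ∧
    (∑ k ∈ Finset.range p, (-(a : ℤ_[p]) + s + 2 * k) * pochRatio a s k ^ 2 *
        shiftedPochRatio a s k ^ 2) *
        ((ascPochhammer ℤ_[p] a).eval (1 + 0) * (ascPochhammer ℤ_[p] a).eval (1 + s)) =
      (-(a : ℤ_[p]) + s) * (ascPochhammer ℤ_[p] a).eval (1 + (-(a : ℤ_[p]) + s)) *
        (ascPochhammer ℤ_[p] a).eval (1 + (a : ℤ_[p]) + 0) ∧
    (∑ k ∈ Finset.range p, (-(a : ℤ_[p]) + s + 2 * k) * pochRatio a s k *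
        shiftedPochRatio a s k ^ 3) * (ascPochhammer ℤ_[p] a).eval (1 + s) ^ 2 =
      (-(a : ℤ_[p]) + s) * (ascPochhammer ℤ_[p] a).eval (1 + (-(a : ℤ_[p]) + s)) *
        (ascPochhammer ℤ_[p] a).eval (1 + a + s) := by
  have h1 := sum_range_wellPoisedTerm ha hs (dvd_zero s) (dvd_zero s)
  have h2 := sum_range_wellPoisedTerm ha hs (dvd_zero s) (dvd_refl s)
  have h3 := sum_range_wellPoisedTerm ha hs (dvd_refl s) (dvd_refl s)
  simp only [PadicInt.coe_zero, sub_zero, add_sub_cancel_right, add_zero, sub_add_cancel]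
    at h1 h2 h3
  have e1 : 1 + (-(a : ℚ_[p]) + s) + a = 1 + s := by ring
  have e2 : 1 + (-(a : ℚ_[p]) + s) - -(a : ℚ_[p]) = 1 + s := by ring
  refine ⟨?_, ?_, ?_⟩ <;> apply PadicInt.ext <;> push_cast <;>
    simp only [PadicInt.coe_ascPochhammer_eval, PadicInt.coe_sum] <;> push_cast
  · simp only [add_zero, ← sub_eq_add_neg]
    rw [← h1, sq]
    congr 1
    refine Finset.sum_congr rfl fun k hk => ?_
    rw [coe_pochRatio (Finset.mem_range.1 hk), coe_shiftedPochRatio (Finset.mem_range.1 hk) hs,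
      PadicInt.coe_two, wellPoisedTerm, e1, add_sub_cancel_right, ascPochhammer_eval_one]
    simp only [div_eq_mul_inv, mul_inv]
    ring
  · simp only [add_zero]
    rw [← h2]
    congr 1
    refine Finset.sum_congr rfl fun k hk => ?_
    rw [coe_pochRatio (Finset.mem_range.1 hk), coe_shiftedPochRatio (Finset.mem_range.1 hk) hs,
      PadicInt.coe_two, wellPoisedTerm, e1, e2, add_sub_cancel_right, ascPochhammer_eval_one]
    simp only [div_eq_mul_inv, mul_inv]
    ring
  · rw [← h3, sq]
    congr 1
    refine Finset.sum_congr rfl fun k hk => ?_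
    rw [coe_pochRatio (Finset.mem_range.1 hk), coe_shiftedPochRatio (Finset.mem_range.1 hk) hs,
      PadicInt.coe_two, wellPoisedTerm, e1, e2]
    simp only [div_eq_mul_inv, mul_inv]
    ring

theorem pow_four_dvd_sum_pochRatio_pow_four_sub (hp : p ≠ 2) {a : ℕ} (ha0 : a ≠ 0) (ha : a < p)
    {s : ℤ_[p]} (hs : (p : ℤ_[p]) ∣ s) :
    (p : ℤ_[p]) ^ 4 ∣
      (∑ k ∈ Finset.range p, (-(a : ℤ_[p]) + s + 2 * k) * pochRatio a s k ^ 4) *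
        (ascPochhammer ℤ_[p] a).eval (1 + -s) ^ 3 -
      (-(a : ℤ_[p]) + s) * (ascPochhammer ℤ_[p] a).eval (1 + (-(a : ℤ_[p]) + s)) *
        ((ascPochhammer ℤ_[p] a).eval (1 + -(2 * s)) *
          (ascPochhammer ℤ_[p] a).eval (1 + a + -(2 * s))) := by
  obtain ⟨h1, h2, h3⟩ := sum_pochRatio_eq ha hs
  have herr := pow_four_dvd_sum_pochRatio hp hs ha
  have hexp : ∑ k ∈ Finset.range p, (-(a : ℤ_[p]) + s + 2 * k) * pochRatio a s k ^ 4 =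
      ∑ k ∈ Finset.range p, (-(a : ℤ_[p]) + s + 2 * k) * pochRatio a s k *
        (pochRatio a s k - shiftedPochRatio a s k) ^ 3 +
      3 * (∑ k ∈ Finset.range p, (-(a : ℤ_[p]) + s + 2 * k) * pochRatio a s k ^ 3 *
        shiftedPochRatio a s k) -
      3 * (∑ k ∈ Finset.range p, (-(a : ℤ_[p]) + s + 2 * k) * pochRatio a s k ^ 2 *
        shiftedPochRatio a s k ^ 2) +
      ∑ k ∈ Finset.range p, (-(a : ℤ_[p]) + s + 2 * k) * pochRatio a s k *
        shiftedPochRatio a s k ^ 3 := by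
    rw [Finset.mul_sum, Finset.mul_sum, ← Finset.sum_add_distrib, ← Finset.sum_sub_distrib,
      ← Finset.sum_add_distrib]
    exact Finset.sum_congr rfl fun k _ => by ring
  have hT := Polynomial.cube_dvd_interpolation
    ((ascPochhammer ℤ_[p] a).comp (1 + Polynomial.X))
    ((ascPochhammer ℤ_[p] a).comp (Polynomial.C (1 + (a : ℤ_[p])) + Polynomial.X)) s
  simp only [Polynomial.eval_comp, Polynomial.eval_add, Polynomial.eval_one, Polynomial.eval_X,
    Polynomial.eval_C] at hT
  -- The last factor of `(1 + s - a)_a` is `s`; this supplies the fourth power of `p`.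
  have hC : (p : ℤ_[p]) ∣ (ascPochhammer ℤ_[p] a).eval (1 + (-(a : ℤ_[p]) + s)) := by
    refine hs.trans ?_
    have := dvd_ascPochhammer_eval (R := ℤ_[p]) (Nat.sub_lt (Nat.pos_of_ne_zero ha0) one_pos) s
    rw [Nat.cast_pred (Nat.pos_of_ne_zero ha0)] at this
    convert this using 2
    ring
  have hu0 := isUnit_ascPochhammer_one_add (p := p) (dvd_zero _) ha
  have hu1 := isUnit_ascPochhammer_one_add hs ha
  obtain ⟨C', hC'⟩ := hC
  have hT' := (pow_dvd_pow_of_dvd hs 3).trans hT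
  -- Multiplying by the unit `E(0)² E(s)²` clears the denominators of all three closed forms.
  rw [hexp, ← ((hu0.pow 2).mul (hu1.pow 2)).dvd_mul_right]
  obtain ⟨t, ht⟩ := hT'
  obtain ⟨d, hd⟩ := herr
  rw [hd]
  generalize ∑ k ∈ Finset.range p, (-(a : ℤ_[p]) + s + 2 * k) * pochRatio a s k ^ 3 *
        shiftedPochRatio a s k = S1 at *
  generalize ∑ k ∈ Finset.range p, (-(a : ℤ_[p]) + s + 2 * k) * pochRatio a s k ^ 2 *
        shiftedPochRatio a s k ^ 2 = S2 at *
  generalize ∑ k ∈ Finset.range p, (-(a : ℤ_[p]) + s + 2 * k) * pochRatio a s k *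
        shiftedPochRatio a s k ^ 3 = S3 at *
  generalize (ascPochhammer ℤ_[p] a).eval (1 + -s) = Em at *
  generalize (ascPochhammer ℤ_[p] a).eval (1 + s) = E1 at *
  generalize (ascPochhammer ℤ_[p] a).eval (1 + 0) = E0 at *
  generalize (ascPochhammer ℤ_[p] a).eval (1 + -(2 * s)) = Em2 at *
  generalize (ascPochhammer ℤ_[p] a).eval (1 + a + -(2 * s)) = Qm2 at *
  generalize (ascPochhammer ℤ_[p] a).eval (1 + a + -s) = Qm at *
  generalize (ascPochhammer ℤ_[p] a).eval (1 + (a : ℤ_[p]) + 0) = Q0 at *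
  generalize (ascPochhammer ℤ_[p] a).eval (1 + a + s) = Q1 at *
  generalize (ascPochhammer ℤ_[p] a).eval (1 + (-(a : ℤ_[p]) + s)) = C at *
  refine ⟨d * Em ^ 3 * E0 ^ 2 * E1 ^ 2 + (-(a : ℤ_[p]) + s) * C' * t, ?_⟩
  linear_combination 3 * Em ^ 3 * E1 ^ 2 * h1 - 3 * Em ^ 3 * E0 * E1 * h2 + Em ^ 3 * E0 ^ 2 * h3 +
    (-(a : ℤ_[p]) + s) * C * ht + (-(a : ℤ_[p]) + s) * t * p ^ 3 * hC'

end Sums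

/-! ### Translation of the Pochhammer products into values of `Γ_p`. -/

section Assembly

variable {p : ℕ} [Fact p.Prime]

theorem prime_dvd_one_add_add_iff {y : ℤ_[p]} (hy : (p : ℤ_[p]) ∣ y) (j : ℕ) :
    (p : ℤ_[p]) ∣ 1 + y + j ↔ p ∣ j + 1 := by
  rw [← PadicInt.prime_dvd_natCast, show 1 + y + (j : ℤ_[p]) = y + ((j + 1 : ℕ) : ℤ_[p]) by
    push_cast; ring, dvd_add_right hy]

theorem prod_unitPart_of_lt {y : ℤ_[p]} (hy : (p : ℤ_[p]) ∣ y) {n : ℕ} (hn : n < p) :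
    ∏ j ∈ Finset.range n, unitPart p (1 + y + (j : ℤ_[p])) =
      (ascPochhammer ℤ_[p] n).eval (1 + y) := by
  rw [ascPochhammer_eval_eq_prod]
  refine Finset.prod_congr rfl fun j hj => unitPart_of_not_dvd ?_
  rw [prime_dvd_one_add_add_iff hy]
  exact Nat.not_dvd_of_pos_of_lt (Nat.succ_pos j) (by have := Finset.mem_range.1 hj; omega)

/-- Since `p ≤ n < 2p`, exactly one factor is divisible by `p`, namely `p + y` at `j = p - 1`. -/
theorem prod_unitPart_of_le {y : ℤ_[p]} (hy : (p : ℤ_[p]) ∣ y) {n : ℕ} (hn : p ≤ n)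
    (hn' : n < 2 * p) :
    (p + y) * ∏ j ∈ Finset.range n, unitPart p (1 + y + (j : ℤ_[p])) =
      (ascPochhammer ℤ_[p] n).eval (1 + y) := by
  have hp0 : 0 < p := (Fact.out : p.Prime).pos
  have hmem : p - 1 ∈ Finset.range n := Finset.mem_range.2 (by omega)
  rw [ascPochhammer_eval_eq_prod, ← Finset.mul_prod_erase _ _ hmem, ← Finset.mul_prod_erase _ _ hmem,
    unitPart_of_dvd ((prime_dvd_one_add_add_iff hy _).2 (by rw [Nat.sub_add_cancel hp0])), one_mul,
    Nat.cast_pred hp0]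
  congr 1
  · ring
  · refine Finset.prod_congr rfl fun j hj => unitPart_of_not_dvd ?_
    rw [Finset.mem_erase, Finset.mem_range] at hj
    rw [prime_dvd_one_add_add_iff hy]
    rintro ⟨c, hc⟩
    have h1 : c < 2 := by
      by_contra h
      have := Nat.mul_le_mul_left p (not_lt.1 h)
      omega
    interval_cases c <;> omega

theorem padicGamma_one_add_add_nat (hp : p ≠ 2) {y : ℤ_[p]} (hy : (p : ℤ_[p]) ∣ y) (n : ℕ) :
    padicGamma p (1 + y + n) = (-1) ^ (n + 1) *
      (∏ j ∈ Finset.range n, unitPart p (1 + y + (j : ℤ_[p]))) * padicGamma p y := by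
  rw [padicGamma_add_nat hp, add_comm 1 y, padicGamma_add_one hp, unitPart_of_dvd hy]
  ring

theorem padicGamma_eq_of_neg_add (hp : p ≠ 2) {s : ℤ_[p]} (hs : (p : ℤ_[p]) ∣ s) {b : ℕ}
    (hb : b < p) :
    padicGamma p s = (-1) ^ b * (ascPochhammer ℤ_[p] b).eval (-(b : ℤ_[p]) + s) *
      padicGamma p (-(b : ℤ_[p]) + s) ∧
    IsUnit ((ascPochhammer ℤ_[p] b).eval (-(b : ℤ_[p]) + s)) := by
  have h := padicGamma_add_nat hp (-(b : ℤ_[p]) + s) b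
  have hu : ∀ j ∈ Finset.range b, ¬ (p : ℤ_[p]) ∣ -(b : ℤ_[p]) + s + j := fun j hj hd => by
    have hj' := Finset.mem_range.1 hj
    have : (p : ℤ_[p]) ∣ ((b - j : ℕ) : ℤ_[p]) := by
      rw [Nat.cast_sub hj'.le, ← dvd_neg, ← dvd_add_right hs]
      convert hd using 1
      ring
    rw [PadicInt.prime_dvd_natCast] at this
    exact Nat.not_dvd_of_pos_of_lt (by omega) (by omega) this
  constructor
  · rw [neg_add_cancel_comm] at h
    rw [h, ascPochhammer_eval_eq_prod, Finset.prod_congr rfl fun j hj => unitPart_of_not_dvd (hu j hj)]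
  · rw [ascPochhammer_eval_eq_prod]
    exact IsUnit.prod_iff.2 fun j hj => (PadicInt.isUnit_iff_not_prime_dvd _).2 (hu j hj)

theorem ascPochhammer_eval_two_mul {R : Type*} [CommRing R] (a : ℕ) (y : R) :
    (ascPochhammer R (2 * a)).eval (1 + y) =
      (ascPochhammer R a).eval (1 + y) * (ascPochhammer R a).eval (1 + a + y) := by
  rw [ascPochhammer_eval_eq_prod, ascPochhammer_eval_eq_prod, ascPochhammer_eval_eq_prod, two_mul,
    Finset.prod_range_add]
  congr 1
  refine Finset.prod_congr rfl fun j _ => ?_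
  push_cast
  ring

/-- The congruence in `ℤ_p` with denominators cleared; `m` is the factor of
`∏_{j ≤ 2a} (j - 2s)` that may be divisible by `p`. -/
theorem pow_four_dvd_sum_mul_padicGamma_add (hp : p ≠ 2) {a : ℕ} (ha0 : a ≠ 0) (ha : a < p)
    {s : ℤ_[p]} (hs : (p : ℤ_[p]) ∣ s) {m : ℤ_[p]}
    (hm : m * ∏ j ∈ Finset.range (2 * a), unitPart p (1 + -(2 * s) + (j : ℤ_[p])) =
      (ascPochhammer ℤ_[p] (2 * a)).eval (1 + -(2 * s)))
    (hΓ : (p : ℤ_[p]) ^ 3 ∣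
      m * (padicGamma p (-(2 * s)) - padicGamma p s * padicGamma p (-s) ^ 3)) :
    (p : ℤ_[p]) ^ 4 ∣
      (∑ k ∈ Finset.range p, (-(a : ℤ_[p]) + s + 2 * k) * pochRatio a s k ^ 4) *
        (padicGamma p (1 + (-(a : ℤ_[p]) + s)) * padicGamma p (1 - (-(a : ℤ_[p]) + s)) ^ 3) +
      (-(a : ℤ_[p]) + s) * (s * m * padicGamma p (1 - 2 * (-(a : ℤ_[p]) + s))) := by
  have h0 := pow_four_dvd_sum_pochRatio_pow_four_sub hp ha0 ha hs
  have hs' : (p : ℤ_[p]) ∣ -s := by simpa using hs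
  have hs2 : (p : ℤ_[p]) ∣ -(2 * s) := by simpa using hs.mul_left 2
  -- With `a = b + 1` one has `1 + α = s - b`: `Γ_p` passes from `1 + α` to `s` through the unit
  -- factors `(s-b)_b`, while `(1+α)_a` has the extra factor `s`.
  obtain ⟨b, rfl⟩ := Nat.exists_eq_succ_of_ne_zero ha0
  obtain ⟨hg2, hu⟩ := padicGamma_eq_of_neg_add hp hs (b := b) (by omega)
  have hg3 := padicGamma_one_add_add_nat hp hs' (b + 1)
  rw [prod_unitPart_of_lt hs' ha] at hg3
  have hg1 := padicGamma_one_add_add_nat hp hs2 (2 * (b + 1))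
  have e2 : 1 + (-((b.succ : ℕ) : ℤ_[p]) + s) = -(b : ℤ_[p]) + s := by push_cast; ring
  have e3 : 1 - (-((b.succ : ℕ) : ℤ_[p]) + s) = 1 + -s + ((b + 1 : ℕ) : ℤ_[p]) := by
    push_cast; ring
  have e1 : 1 - 2 * (-((b.succ : ℕ) : ℤ_[p]) + s) = 1 + -(2 * s) + ((2 * (b + 1) : ℕ) : ℤ_[p]) := by
    push_cast; ring
  have eC : (ascPochhammer ℤ_[p] b.succ).eval (-(b : ℤ_[p]) + s) =
      (ascPochhammer ℤ_[p] b).eval (-(b : ℤ_[p]) + s) * s := by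
    rw [Nat.succ_eq_add_one, ascPochhammer_succ_eval]
    ring
  rw [e2, eC] at h0
  rw [e2, e3, e1, hg3, hg1]
  rw [ascPochhammer_eval_two_mul, Nat.succ_eq_add_one] at hm
  rw [Nat.succ_eq_add_one] at h0 ⊢
  generalize (∑ k ∈ Finset.range p, (-((b + 1 : ℕ) : ℤ_[p]) + s + 2 * k) *
    pochRatio (b + 1) s k ^ 4) = T at *
  generalize (ascPochhammer ℤ_[p] b).eval (-(b : ℤ_[p]) + s) = C at *
  generalize padicGamma p (-(b : ℤ_[p]) + s) = g2 at *
  generalize ∏ j ∈ Finset.range (2 * (b + 1)), unitPart p (1 + -(2 * s) + (j : ℤ_[p])) = M at *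
  generalize (ascPochhammer ℤ_[p] (b + 1)).eval (1 + -s) = Em at *
  rw [← hm] at h0
  -- Multiplying by the unit `(s-b)_b` turns `Γ_p(1+α)` into `±Γ_p(s)`.
  rw [← hu.dvd_mul_left]
  obtain ⟨x, hx⟩ := h0
  obtain ⟨y, hy⟩ := hΓ
  obtain ⟨w, hw⟩ := hs
  have hsg : ((-1 : ℤ_[p]) ^ b) ^ 2 = 1 := by rw [← pow_mul, mul_comm, pow_mul]; norm_num
  have hsg2 : (-1 : ℤ_[p]) ^ (2 * (b + 1) + 1) = -1 := by rw [pow_succ, pow_mul]; norm_num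
  have hsg3 : ((-1 : ℤ_[p]) ^ (b + 1 + 1)) ^ 3 = (-1) ^ b := by
    rw [pow_succ, pow_succ]
    linear_combination (-1 : ℤ_[p]) ^ b * hsg
  rw [mul_pow, mul_pow, hsg2, hsg3]
  generalize padicGamma p (-s) = γ at *
  generalize padicGamma p (-(2 * s)) = δ at *
  generalize padicGamma p s = G at *
  refine ⟨x * G * γ ^ 3 - (-((b + 1 : ℕ) : ℤ_[p]) + s) * C * w * M * y, ?_⟩
  linear_combination (-T * Em ^ 3 * γ ^ 3) * hg2 + G * γ ^ 3 * hx -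
    (-((b + 1 : ℕ) : ℤ_[p]) + s) * C * s * M * hy -
    (-((b + 1 : ℕ) : ℤ_[p]) + s) * C * M * p ^ 3 * y * hw

theorem mul_wellPoised5F4_eq {a : ℕ} {s : ℤ_[p]} (h : (-(a : ℚ_[p]) + s) ≠ 0) :
    (-(a : ℚ_[p]) + s) * wellPoised5F4 p (-(a : ℚ_[p]) + s) (p - 1) =
      ((∑ k ∈ Finset.range p, (-(a : ℤ_[p]) + s + 2 * k) * pochRatio a s k ^ 4 : ℤ_[p]) : ℚ_[p]) := by
  rw [wellPoised5F4_eq_sum p _ _ h, Nat.sub_add_cancel (Fact.out : p.Prime).one_le, Finset.mul_sum,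
    PadicInt.coe_sum]
  refine Finset.sum_congr rfl fun k hk => ?_
  push_cast
  rw [coe_pochRatio (Finset.mem_range.1 hk), PadicInt.coe_two]
  field_simp

theorem PadicInt.prime_dvd_add_zmodRepr_neg (α : ℤ_[p]) :
    (p : ℤ_[p]) ∣ α + ((-α).zmodRepr : ℤ_[p]) := by
  have := PadicInt.sub_zmodRepr_mem (-α)
  rw [PadicInt.maximalIdeal_eq_span_p, Ideal.mem_span_singleton, ← dvd_neg] at this
  convert this using 1
  ring

/-- Common form of both cases, to be used with `m = p - 2s` or `m = 1`. -/
theorem padicCongr_wellPoised5F4 (hp : p ≠ 2) {α : ℤ_[p]} (hα : IsUnit α) {m : ℤ_[p]}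
    (hm : m * ∏ j ∈ Finset.range (2 * (-α).zmodRepr),
      unitPart p (1 + -(2 * (α + ((-α).zmodRepr : ℤ_[p]))) + (j : ℤ_[p])) =
      (ascPochhammer ℤ_[p] (2 * (-α).zmodRepr)).eval (1 + -(2 * (α + ((-α).zmodRepr : ℤ_[p])))))
    (hΓ : (p : ℤ_[p]) ^ 3 ∣ m * (padicGamma p (-(2 * (α + ((-α).zmodRepr : ℤ_[p])))) -
      padicGamma p (α + ((-α).zmodRepr : ℤ_[p])) *
        padicGamma p (-(α + ((-α).zmodRepr : ℤ_[p]))) ^ 3)) :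
    PadicCongr p 4 (wellPoised5F4 p (α : ℚ_[p]) (p - 1))
      (-((p : ℚ_[p]) * padicDash p α * (m : ℚ_[p]) * ((padicGamma p (1 - 2 * α) : ℚ_[p]) /
        ((padicGamma p (1 + α) : ℚ_[p]) * (padicGamma p (1 - α) : ℚ_[p]) ^ 3)))) := by
  have hs := PadicInt.prime_dvd_add_zmodRepr_neg α
  have ha := PadicInt.zmodRepr_lt_p (-α)
  have ha0 : (-α).zmodRepr ≠ 0 := by
    rw [Ne, PadicInt.zmodRepr_eq_zero_iff_dvd, dvd_neg, ← PadicInt.isUnit_iff_not_prime_dvd]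
    exact hα
  have hdash : (p : ℚ_[p]) * padicDash p α = ((α + ((-α).zmodRepr : ℤ_[p]) : ℤ_[p]) : ℚ_[p]) := by
    have : (p : ℚ_[p]) ≠ 0 := by exact_mod_cast (Fact.out : p.Prime).ne_zero
    rw [padicDash]
    push_cast
    field_simp
  rw [hdash]
  have key := pow_four_dvd_sum_mul_padicGamma_add hp ha0 ha hs hm hΓ
  have hαs : α = -((-α).zmodRepr : ℤ_[p]) + (α + ((-α).zmodRepr : ℤ_[p])) := by ring
  have hαs' : (α : ℚ_[p]) = -((-α).zmodRepr : ℚ_[p]) +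
      ((α + ((-α).zmodRepr : ℤ_[p]) : ℤ_[p]) : ℚ_[p]) := by push_cast; ring
  have hα0 := PadicInt.coe_ne_zero_of_isUnit hα
  have hF := mul_wellPoised5F4_eq (p := p) (a := (-α).zmodRepr)
    (s := α + ((-α).zmodRepr : ℤ_[p])) (by rw [← hαs']; exact hα0)
  rw [← hαs'] at hF
  rw [← hαs] at key
  obtain ⟨z, hz⟩ := key
  have u2 := isUnit_padicGamma hp (1 + α)
  have u3 := isUnit_padicGamma hp (1 - α)
  have n2 := PadicInt.coe_ne_zero_of_isUnit u2
  have n3 := PadicInt.coe_ne_zero_of_isUnit u3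
  have hz' := congrArg (fun x : ℤ_[p] => (x : ℚ_[p])) hz
  rw [← hαs] at hF
  simp only [PadicInt.coe_add, PadicInt.coe_mul, PadicInt.coe_pow, ← hF, PadicInt.coe_natCast] at hz'
  refine ⟨z * Ring.inverse (α * (padicGamma p (1 + α) * padicGamma p (1 - α) ^ 3)), ?_⟩
  rw [PadicInt.coe_mul, PadicInt.coe_inverse (hα.mul (u2.mul (u3.pow 3)))]
  push_cast
  field_simp
  linear_combination hz'

end Assembly

/-! ### The two cases of the theorem. -/

theorem theorem9p3 (p : ℕ) [Fact p.Prime] (hp : p ≠ 2) (α : ℤ_[p]) (hα : IsUnit α) :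
    (((p : ℚ) + 1) / 2 ≤ ((-α).zmodRepr : ℚ) →
      PadicCongr p 4 (wellPoised5F4 p (α : ℚ_[p]) (p - 1))
        (-((p : ℚ_[p]) ^ 2 * padicDash p α * (1 - 2 * padicDash p α) *
          ((padicGamma p (1 - 2 * α) : ℚ_[p]) /
            ((padicGamma p (1 + α) : ℚ_[p]) * (padicGamma p (1 - α) : ℚ_[p]) ^ 3))))) ∧
    (5 ≤ p → ((-α).zmodRepr : ℚ) ≤ ((p : ℚ) - 1) / 2 →
      PadicCongr p 4 (wellPoised5F4 p (α : ℚ_[p]) (p - 1))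
        (-((p : ℚ_[p]) * padicDash p α *
          ((padicGamma p (1 - 2 * α) : ℚ_[p]) /
            ((padicGamma p (1 + α) : ℚ_[p]) * (padicGamma p (1 - α) : ℚ_[p]) ^ 3))))) := by
  have hs := PadicInt.prime_dvd_add_zmodRepr_neg α
  have hs2 : (p : ℤ_[p]) ∣ -(2 * (α + ((-α).zmodRepr : ℤ_[p]))) := by simpa using hs.mul_left 2
  have ha := PadicInt.zmodRepr_lt_p (-α)
  constructor
  · intro h
    have h' : p ≤ 2 * (-α).zmodRepr := by
      have : ((p : ℚ) + 1) ≤ 2 * ((-α).zmodRepr : ℚ) := by linarith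
      have : p + 1 ≤ 2 * (-α).zmodRepr := by exact_mod_cast this
      omega
    -- Here `m = p - 2s` already contributes one `p`, so the `Γ_p` congruence modulo `p^2` suffices
    -- and `p = 3` is allowed.
    have key := padicCongr_wellPoised5F4 hp hα (prod_unitPart_of_le hs2 h' (by omega)) (by
      rw [pow_succ']
      exact mul_dvd_mul (dvd_add (dvd_refl _) hs2)
        (pow_dvd_padicGamma_neg_two_mul_sub hp hs (Or.inl rfl)))
    convert key using 3
    have : (p : ℚ_[p]) ≠ 0 := by exact_mod_cast (Fact.out : p.Prime).ne_zero
    rw [padicDash]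
    push_cast
    rw [PadicInt.coe_two]
    field_simp
    ring
  · intro h5 h
    have h' : 2 * (-α).zmodRepr < p := by
      have : 2 * ((-α).zmodRepr : ℚ) + 1 ≤ p := by linarith
      have : 2 * (-α).zmodRepr + 1 ≤ p := by exact_mod_cast this
      omega
    -- No factor of `(1-2s)_{2a}` is divisible by `p`, so the `Γ_p` congruence is needed modulo
    -- `p^3`, hence `p ≥ 5`.
    have key := padicCongr_wellPoised5F4 hp hα (m := 1)
      (by rw [one_mul]; exact prod_unitPart_of_lt hs2 h')
      (by rw [one_mul]; exact pow_dvd_padicGamma_neg_two_mul_sub hp hs (Or.inr ⟨rfl, h5⟩))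
    rwa [PadicInt.coe_one, mul_one] at key
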